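/- Let $\Gamma$ be a group. A \emph{character} of $\Gamma$ is a function $\varphi\colon\Gamma\to\mathbb C$ that is conjugation invariant and positive definite, i.e. $\sum_{i,j=1}^n\lambda_i\bar\lambda_j\varphi(g_j^{-1}g_i)\ge 0$ for all $n$, $\lambda_1,\dots,\lambda_n\in\mathbb C$ and $g_1,\dots,g_n\in\Gamma$; it is \emph{normalized} if $\varphi(e)=1$. An \emph{extremal character} is an extreme point of the convex set of normalized characters of $\Gamma$. Let $R$ be a commutative ring with unit group $R^\times$. For $\alpha\in R^\times$ put $U_\alpha=\left\{\begin{pmatrix}1&\beta\\0&1\end{pmatrix} : \beta\in(\alpha^2-1)R\right\}$ and let $U_\alpha^t$ be the group of transposes of elements of $U_\alpha$; let $D=\left\{\begin{pmatrix}\beta&0\\0&\beta^{-1}\end{pmatrix} : \beta\in R^\times\right\}$. Suppose that $\langle U_\alpha,U_\alpha^t\rangle$ has finite index in $SL_2(R)$ for every $\alpha\in R^\times$ with $\alpha^2\ne1$, and let $\tau\colon SL_2(R)\to\mathbb C$ be an extremal character. Then at least one of the following holds: 1. $\tau$ factors through a finite quotient of $SL_2(R)$; 2. for each $\varepsilon>0$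 and each $\alpha\in R^\times$ of infinite order there exists $k_0$ such that for all $\beta\in R$ and all $k\in\mathbb Z$ with $|k|\ge k_0$, $$\left|\tau\begin{pmatrix}\alpha^k&\beta\\0&\alpha^{-k}\end{pmatrix}\right|<\varepsilon .$$ Moreover, if $R$ is a field, then $\tau$ is the constant character $1$, or the restriction of $\tau$ to $D$ vanishes at infinity, i.e. for every $\varepsilon>0$ the set $\{d\in D : |\tau(d)|\ge\varepsilon\}$ is finite. -/

import Mathlib

open scoped ComplexOrder

namespace CharSL2

section Characters

variable {Γ : Type*} [Group Γ]

/-- Positive definite functions on a group. The inequality is in `ℂ`: the sum is real and `≥ 0`. -/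
def IsPositiveDefinite (φ : Γ → ℂ) : Prop :=
  ∀ (n : ℕ) (c : Fin n → ℂ) (g : Fin n → Γ),
    0 ≤ ∑ i, ∑ j, c i * (starRingEnd ℂ) (c j) * φ ((g j)⁻¹ * g i)

/-- Characters: positive definite class functions. -/
structure IsCharacter (φ : Γ → ℂ) : Prop where
  posDef : IsPositiveDefinite φ
  conj_inv : ∀ g h : Γ, φ (h * g * h⁻¹) = φ g

/-- The convex set of normalized characters. -/
def normalizedCharacters (Γ : Type*) [Group Γ] : Set (Γ → ℂ) :=
  {φ | IsCharacter φ ∧ φ 1 = 1}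

/-- Extremal characters: extreme points of the set of normalized characters. -/
def IsExtremalCharacter (τ : Γ → ℂ) : Prop :=
  τ ∈ Set.extremePoints ℝ (normalizedCharacters Γ)

/-- `τ` is the composition of a quotient map `Γ → Γ ⧸ N`, `Γ ⧸ N` finite, and a function. -/
def FactorsThroughFiniteQuotient (τ : Γ → ℂ) : Prop :=
  ∃ N : Subgroup Γ, N.Normal ∧ N.FiniteIndex ∧
    ∃ σ : Γ ⧸ N → ℂ, ∀ g : Γ, τ g = σ (QuotientGroup.mk g)

end Characters

section SL2

variable {R : Type*} [CommRing R]

/-- The matrix `(a, b; 0, a⁻¹)` in `SL₂(R)`. -/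
def upper (a : Rˣ) (b : R) : Matrix.SpecialLinearGroup (Fin 2) R :=
  ⟨!![(a : R), b; 0, ((a⁻¹ : Rˣ) : R)], by simp [Matrix.det_fin_two]⟩

theorem upper_mul (a c : Rˣ) (b d : R) :
    upper a b * upper c d = upper (a * c) ((a : R) * d + b * ((c⁻¹ : Rˣ) : R)) := by
  ext i j
  rw [Matrix.SpecialLinearGroup.coe_mul]
  fin_cases i <;> fin_cases j <;> simp [upper, Matrix.mul_apply, Fin.sum_univ_two, mul_comm]

theorem upper_one_zero : upper (1 : Rˣ) (0 : R) = 1 := by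
  ext i j
  fin_cases i <;> fin_cases j <;> simp [upper]

/-- The unipotent group `U_α`, with upper right entries in the ideal `(α² - 1)R`. -/
def unipotent (α : Rˣ) : Subgroup (Matrix.SpecialLinearGroup (Fin 2) R) where
  carrier := {g | ∃ β ∈ Ideal.span {(α : R) ^ 2 - 1}, g = upper 1 β}
  one_mem' := ⟨0, Submodule.zero_mem _, upper_one_zero.symm⟩
  mul_mem' := by
    rintro _ _ ⟨β, hβ, rfl⟩ ⟨γ, hγ, rfl⟩
    exact ⟨γ + β, Submodule.add_mem _ hγ hβ, by simp [upper_mul]⟩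
  inv_mem' := by
    rintro _ ⟨β, hβ, rfl⟩
    refine ⟨-β, Submodule.neg_mem _ hβ, ?_⟩
    rw [inv_eq_iff_mul_eq_one, upper_mul, ← upper_one_zero]
    simp

/-- The subgroup `⟨U_α, U_α^t⟩` of `SL₂(R)`. -/
def unipotentPair (α : Rˣ) : Subgroup (Matrix.SpecialLinearGroup (Fin 2) R) :=
  Subgroup.closure
    ((unipotent α : Set (Matrix.SpecialLinearGroup (Fin 2) R)) ∪
      Matrix.SpecialLinearGroup.transpose ''
        (unipotent α : Set (Matrix.SpecialLinearGroup (Fin 2) R)))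

/-- The diagonal subgroup `D` of `SL₂(R)`. -/
def diagonalSubgroup (R : Type*) [CommRing R] :
    Subgroup (Matrix.SpecialLinearGroup (Fin 2) R) where
  carrier := {g | ∃ a : Rˣ, g = upper a 0}
  one_mem' := ⟨1, upper_one_zero.symm⟩
  mul_mem' := by
    rintro _ _ ⟨a, rfl⟩ ⟨b, rfl⟩
    exact ⟨a * b, by simp [upper_mul]⟩
  inv_mem' := by
    rintro _ ⟨a, rfl⟩
    refine ⟨a⁻¹, ?_⟩
    rw [inv_eq_iff_mul_eq_one, upper_mul, ← upper_one_zero]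
    simp

end SL2

end CharSL2

/-! The GNS construction turns `τ` into a Hilbert space with commuting left and right actions of the
group and a vector ξ fixed by conjugation, with τ(g) = ⟨ξ, gξ⟩. On operators commuting with the
right action, T ↦ ⟨ξ, Tξ⟩ is a trace, so a closed right-invariant subspace K has a dimension ‖p_K
ξ‖². It can be compared (`norm_starProjection_vec_le`) and is continuous (`exists_inf_ne_bot`).

Suppose |τ(d_i)| ≥ ε for infinitely many upper triangular d_i with diagonal parts a_i. Let V_l, W_l
be the upper and lower unipotent groups over decreasing ideals I_l, and X, Y the closures of the
unions of their fixed spaces. Conjugation by upper unipotents moves d_j⁻¹d_i through its whole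
V_l-coset for some l; hence the d_i-translates of the Xᗮ-part of ξ are pairwise orthogonal and tend
weakly to zero. So τ(d_i) is carried by V_m-fixed vectors, on which d_i acts as a_i up to finitely
many factors. A weak limit of a_i-translates is then nonzero and V_m-fixed, and the same
orthogonality for the lower groups puts it in Y. Continuity of dimension yields a nonzero vector
fixed by some V_l and W_l together (`exists_fixed`).

With I_l generated by α^(2·l!) - 1 these generate a subgroup of finite index; over a field, with I_l
= R, they generate everything. The vectors fixed by a normal subgroup form a bi-invariant subspace,
which would split `τ`; extremality forces ξ into it (`vec_mem_fixed_of_extremal`), so `τ` factors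
through the quotient. -/

namespace CharSL2

/-! ### The GNS construction for characters. -/

section GNS

universe u

variable {Γ : Type u} [Group Γ] {τ : Γ → ℂ}

theorem IsPositiveDefinite.map_inv (h : IsPositiveDefinite τ) (g : Γ) :
    τ g⁻¹ = (starRingEnd ℂ) (τ g) := by
  -- Only reality of the sums is used: coefficients (1, 1) give the imaginary part of the symmetry,
  -- (1, i) the real part.
  have h0 := (Complex.nonneg_iff.1 (h 1 ![1] ![1])).2
  have h1 := (Complex.nonneg_iff.1 (h 2 ![1, 1] ![1, g])).2
  have h2 := (Complex.nonneg_iff.1 (h 2 ![1, Complex.I] ![1, g])).2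
  simp [Fin.sum_univ_two] at h0 h1 h2
  apply Complex.ext
  · simp; linarith
  · simp; linarith

theorem IsPositiveDefinite.finsupp_sum_nonneg (h : IsPositiveDefinite τ) (f : Γ →₀ ℂ) :
    0 ≤ f.sum fun s z => f.sum fun t w => (starRingEnd ℂ) z * w * τ (s⁻¹ * t) := by
  classical
  have e := f.support.equivFin.symm
  have := h f.support.card (fun i => f (e i)) (fun i => e i)
  rw [e.sum_comp (fun s : f.support => ∑ j, f s * (starRingEnd ℂ) (f (e j)) * τ ((e j : Γ)⁻¹ * s)),
    Finset.sum_comm' (t' := Finset.univ) (s' := fun _ => Finset.univ) (by simp)] at this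
  rw [e.sum_comp (fun s : f.support => ∑ t : f.support, f t * (starRingEnd ℂ) (f s) *
    τ ((s : Γ)⁻¹ * t))] at this
  convert this using 1
  simp only [Finsupp.sum]
  rw [← Finset.sum_coe_sort f.support]
  refine Finset.sum_congr rfl fun s _ => ?_
  rw [← Finset.sum_coe_sort f.support]
  refine Finset.sum_congr rfl fun t _ => ?_
  ring

/-- The positive semidefinite form on finitely supported functions defined by a positive
definite function. -/
noncomputable abbrev IsPositiveDefinite.core (h : IsPositiveDefinite τ) :
    PreInnerProductSpace.Core ℂ (Γ →₀ ℂ) where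
  inner f g := f.sum fun s z => g.sum fun t w => (starRingEnd ℂ) z * w * τ (s⁻¹ * t)
  conj_inner_symm f g := by
    rw [Finsupp.sum_comm]
    simp only [map_finsuppSum]
    congr! 6 with s z t w
    rw [map_mul, map_mul, ← h.map_inv]
    simp [mul_comm]
  re_inner_nonneg f := (Complex.nonneg_iff.1 (h.finsupp_sum_nonneg f)).1
  add_left _ _ _ := by
    rw [Finsupp.sum_add_index'] <;> simp [← Finsupp.sum_add, add_mul]
  smul_left _ _ _ := by
    rw [Finsupp.sum_smul_index] <;> simp [Finsupp.mul_sum, ← mul_assoc]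

/-- A positive definite function is the Gram matrix of a total family in a Hilbert space. -/
theorem IsPositiveDefinite.exists_gram (h : IsPositiveDefinite τ) :
    ∃ (H : Type u) (_ : NormedAddCommGroup H) (_ : InnerProductSpace ℂ H) (_ : CompleteSpace H)
      (e : (Γ →₀ ℂ) →ₗ[ℂ] H), DenseRange e ∧
      ∀ f g : Γ →₀ ℂ, inner ℂ (e f) (e g) =
        f.sum fun s z => g.sum fun t w => (starRingEnd ℂ) z * w * τ (s⁻¹ * t) := by
  let := h.core
  let : SeminormedAddCommGroup (Γ →₀ ℂ) :=
    InnerProductSpace.Core.toSeminormedAddCommGroup (𝕜 := ℂ)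
  let : InnerProductSpace ℂ (Γ →₀ ℂ) := .ofCore _
  refine ⟨UniformSpace.Completion (Γ →₀ ℂ), inferInstance, inferInstance, inferInstance,
    (UniformSpace.Completion.toComplL (𝕜 := ℂ) (E := Γ →₀ ℂ)).toLinearMap, ?_, ?_⟩
  · exact UniformSpace.Completion.denseRange_coe
  · intro f g
    exact UniformSpace.Completion.inner_coe f g

/-- A Hilbert space with commuting left and right unitary representations and a cyclic vector
that is fixed under conjugation and has matrix coefficient `τ`. -/
structure BiRep (τ : Γ → ℂ) (H : Type*) [NormedAddCommGroup H] [InnerProductSpace ℂ H] where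
  lam : Γ → H ≃ₗᵢ[ℂ] H
  rho : Γ → H ≃ₗᵢ[ℂ] H
  vec : H
  flip : H ≃ₗᵢ⋆[ℂ] H
  lam_mul : ∀ g h v, lam (g * h) v = lam g (lam h v)
  rho_mul : ∀ g h v, rho (g * h) v = rho g (rho h v)
  lam_rho : ∀ g h v, lam g (rho h v) = rho h (lam g v)
  rho_vec : ∀ g, rho g vec = lam g⁻¹ vec
  flip_vec : ∀ g, flip (lam g vec) = lam g⁻¹ vec
  inner_vec : ∀ g, inner ℂ vec (lam g vec) = τ g
  dense : Dense (Submodule.span ℂ (Set.range fun g => lam g vec) : Set H)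

/-- The conjugate-linear involution of finitely supported functions induced by `g ↦ g⁻¹`. -/
noncomputable def finsuppFlip (Γ : Type*) [Group Γ] : (Γ →₀ ℂ) ≃ₛₗ[starRingEnd ℂ] (Γ →₀ ℂ) where
  toFun f := (f.mapRange (starRingEnd ℂ) (map_zero _)).equivMapDomain (Equiv.inv Γ)
  invFun f := (f.mapRange (starRingEnd ℂ) (map_zero _)).equivMapDomain (Equiv.inv Γ)
  map_add' f g := by ext; simp
  map_smul' c f := by ext; simp
  left_inv f := by ext; simp
  right_inv f := by ext; simp

/-- Left translation preserves any form depending on s⁻¹t; conjugation invariance is what makes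
right translation and inversion isometric too. -/
theorem IsCharacter.exists_biRep (h : IsCharacter τ) :
    ∃ (H : Type u) (_ : NormedAddCommGroup H) (_ : InnerProductSpace ℂ H) (_ : CompleteSpace H),
      Nonempty (BiRep τ H) := by
  obtain ⟨H, _, _, _, e, he, hin⟩ := h.posDef.exists_gram
  refine ⟨H, inferInstance, inferInstance, inferInstance, ?_⟩
  have hcomm : ∀ a b : Γ, τ (a * b) = τ (b * a) := fun a b => by
    rw [← h.conj_inv (b * a) a]; group
  have hnorm : ∀ f g : Γ →₀ ℂ, inner ℂ (e f) (e f) = inner ℂ (e g) (e g) → ‖e f‖ = ‖e g‖ := by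
    intro f g hfg
    rw [@norm_eq_sqrt_re_inner ℂ, hfg, ← @norm_eq_sqrt_re_inner ℂ]
  have nl : ∀ (σ : Equiv.Perm Γ), (∀ s t, τ ((σ s)⁻¹ * σ t) = τ (s⁻¹ * t)) → ∀ f,
      ‖e (Finsupp.domLCongr (R := ℂ) (M := ℂ) σ f)‖ = ‖e f‖ := by
    intro σ hσ f
    apply hnorm
    simp only [hin, Finsupp.domLCongr_apply, Finsupp.domCongr_apply, Finsupp.sum_equivMapDomain, hσ]
  have nJ : ∀ f, ‖e (finsuppFlip Γ f)‖ = ‖e f‖ := by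
    intro f
    apply hnorm
    simp only [hin, finsuppFlip, LinearEquiv.coe_mk, LinearMap.coe_mk, AddHom.coe_mk,
      Finsupp.sum_equivMapDomain]
    rw [Finsupp.sum_mapRange_index (fun _ => by simp [Finsupp.sum])]
    rw [Finsupp.sum_comm f f]
    refine Finsupp.sum_congr fun s _ => ?_
    rw [Finsupp.sum_mapRange_index (fun _ => by simp)]
    refine Finsupp.sum_congr fun t _ => ?_
    rw [hcomm]
    simp [mul_comm]
  let L : Γ → H ≃ₗᵢ[ℂ] H := fun g =>
    (Finsupp.domLCongr (R := ℂ) (M := ℂ) (Equiv.mulLeft g)).extendOfIsometry e e he he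
      (nl _ fun s t => by simp [mul_assoc])
  let R : Γ → H ≃ₗᵢ[ℂ] H := fun g =>
    (Finsupp.domLCongr (R := ℂ) (M := ℂ) (Equiv.mulRight g⁻¹)).extendOfIsometry e e he he
      (nl _ fun s t => by rw [hcomm]; simp; rw [hcomm])
  let J : H ≃ₗᵢ⋆[ℂ] H := (finsuppFlip Γ).extendOfIsometry e e he he nJ
  have hL : ∀ g f, L g (e f) = e (f.equivMapDomain (Equiv.mulLeft g)) := fun g f =>
    LinearEquiv.extendOfIsometry_eq ..
  have hR : ∀ g f, R g (e f) = e (f.equivMapDomain (Equiv.mulRight g⁻¹)) := fun g f =>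
    LinearEquiv.extendOfIsometry_eq ..
  have hJ : ∀ f, J (e f) = e (finsuppFlip Γ f) := fun f =>
    LinearEquiv.extendOfIsometry_eq ..
  have hLv : ∀ g, L g (e (Finsupp.single 1 1)) = e (Finsupp.single g 1) := fun g => by
    rw [hL]; simp
  refine ⟨⟨L, R, e (Finsupp.single 1 1), J, ?_, ?_, ?_, ?_, ?_, ?_, ?_⟩⟩
  · intro g h v
    refine he.induction (P := fun v => L (g * h) v = L g (L h v)) ?_
      (isClosed_eq (by fun_prop) (by fun_prop)) v
    rintro _ ⟨f, rfl⟩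
    simp only [hL, ← Finsupp.equivMapDomain_trans]
    congr 2; ext; simp
  · intro g h v
    refine he.induction (P := fun v => R (g * h) v = R g (R h v)) ?_
      (isClosed_eq (by fun_prop) (by fun_prop)) v
    rintro _ ⟨f, rfl⟩
    simp only [hR, ← Finsupp.equivMapDomain_trans]
    congr 2; ext; simp [mul_assoc]
  · intro g h v
    refine he.induction (P := fun v => L g (R h v) = R h (L g v)) ?_
      (isClosed_eq (by fun_prop) (by fun_prop)) v
    rintro _ ⟨f, rfl⟩
    simp only [hR, hL, ← Finsupp.equivMapDomain_trans]
    congr 2; ext; simp [mul_assoc]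
  · intro g
    rw [hLv, hR]; simp
  · intro g
    rw [hLv, hLv, hJ]; simp [finsuppFlip]
  · intro g
    rw [hLv, hin]; simp
  · refine he.mono ?_
    rintro _ ⟨f, rfl⟩
    simp only [hLv]
    induction f using Finsupp.induction_linear with
    | zero => simp
    | add f g hf hg => rw [map_add]; exact Submodule.add_mem _ hf hg
    | single g c =>
      rw [← mul_one c, ← smul_eq_mul, ← Finsupp.smul_single, map_smul]
      exact Submodule.smul_mem _ _ (Submodule.subset_span ⟨g, rfl⟩)

end GNS

/-! ### Weak convergence and projections in Hilbert spaces. -/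

section Hilbert

open Filter Topology

variable {H : Type*} [NormedAddCommGroup H] [InnerProductSpace ℂ H]

theorem inner_map_map_of_conj (J : H ≃ₗᵢ⋆[ℂ] H) (a b : H) :
    inner ℂ (J a) (J b) = inner ℂ b a := by
  have hI : ∀ c : ℂ, J (c • b) = (starRingEnd ℂ) c • J b := fun c => J.map_smulₛₗ c b
  rw [← inner_conj_symm b a, inner_eq_sum_norm_sq_div_four (𝕜 := ℂ) (J a),
    inner_eq_sum_norm_sq_div_four (𝕜 := ℂ) a]
  have h1 : ‖J a + J b‖ = ‖a + b‖ := by rw [← map_add, J.norm_map]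
  have h2 : ‖J a - J b‖ = ‖a - b‖ := by rw [← map_sub, J.norm_map]
  have h3 : ‖J a - (RCLike.I : ℂ) • J b‖ = ‖a + (RCLike.I : ℂ) • b‖ := by
    rw [← J.norm_map (a + _), map_add, hI]; simp [sub_eq_add_neg]
  have h4 : ‖J a + (RCLike.I : ℂ) • J b‖ = ‖a - (RCLike.I : ℂ) • b‖ := by
    rw [← J.norm_map (a - _), map_sub, hI]; simp
  rw [h1, h2, h3, h4]
  have h5 : (starRingEnd ℂ) 4 = 4 := Complex.conj_ofNat 4
  simp [h5]
  ring

theorem starProjection_comm_of_invariant (e : H ≃ₗᵢ[ℂ] H) (K : Submodule ℂ H)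
    [K.HasOrthogonalProjection] (h1 : ∀ v ∈ K, e v ∈ K) (h2 : ∀ v ∈ K, e.symm v ∈ K) (v : H) :
    K.starProjection (e v) = e (K.starProjection v) := by
  apply Submodule.eq_starProjection_of_mem_orthogonal (h1 _ (K.starProjection_apply_mem v))
  rw [← map_sub, Submodule.mem_orthogonal]
  intro u hu
  rw [← e.apply_symm_apply u, e.inner_map_map]
  exact (Submodule.mem_orthogonal _ _).1 (K.sub_starProjection_mem_orthogonal v) _ (h2 u hu)

theorem closure_iSup_invariant {ι : Type*} (e : H ≃ₗᵢ[ℂ] H) (L : ι → Submodule ℂ H)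
    (he : ∀ l, ∀ v ∈ L l, e v ∈ L l) :
    ∀ v ∈ (⨆ l, L l).topologicalClosure, e v ∈ (⨆ l, L l).topologicalClosure := fun v hv => by
  set X := (⨆ l, L l).topologicalClosure
  have h1 : ⨆ l, L l ≤ X.comap e.toLinearEquiv.toLinearMap := iSup_le fun l v hv =>
    Submodule.le_topologicalClosure _ (le_iSup L l (he l v hv))
  have h2 : IsClosed ((X.comap e.toLinearEquiv.toLinearMap : Submodule ℂ H) : Set H) :=
    (Submodule.isClosed_topologicalClosure _).preimage e.continuous
  exact Submodule.topologicalClosure_minimal _ h1 h2 hv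

/-- Bounded families in a Hilbert space converge weakly along ultrafilters. -/
theorem exists_weak_limit [CompleteSpace H] {ι : Type*} (F : Ultrafilter ι) (v : ι → H) (C : ℝ)
    (hv : ∀ i, ‖v i‖ ≤ C) :
    ∃ w : H, ∀ y, Tendsto (fun i => inner ℂ (v i) y) F (𝓝 (inner ℂ w y)) := by
  have hc := WeakDual.isCompact_closedBall (𝕜 := ℂ) (E := H) 0 C
  let f : ι → WeakDual ℂ H := fun i => StrongDual.toWeakDual (InnerProductSpace.toDual ℂ H (v i))
  obtain ⟨φ, -, hφ⟩ := hc.ultrafilter_le_nhds (F.map f) (by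
    rw [le_principal_iff]
    refine Filter.mem_map.2 (Filter.univ_mem' fun i => ?_)
    simpa [f] using hv i)
  refine ⟨(InnerProductSpace.toDual ℂ H).symm (WeakDual.toStrongDual φ), fun y => ?_⟩
  rw [InnerProductSpace.toDual_symm_apply]
  exact ((WeakDual.eval_continuous y).tendsto φ).comp hφ

/-- An orthogonal family of vectors of constant norm converges weakly to zero. -/
theorem tendsto_inner_zero_of_orthogonal {ι : Type*} (v : ι → H) (C : ℝ)
    (hn : ∀ i, ‖v i‖ = C) (ho : ∀ i j, i ≠ j → inner ℂ (v i) (v j) = 0) (y : H) :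
    Tendsto (fun i => inner ℂ (v i) y) cofinite (𝓝 0) := by
  rcases eq_or_ne C 0 with rfl | hC
  · have : ∀ i, v i = 0 := fun i => norm_eq_zero.1 (hn i)
    simpa [this] using tendsto_const_nhds
  have hor : Orthonormal ℂ fun i => ((C⁻¹ : ℝ) : ℂ) • v i := by
    refine ⟨fun i => ?_, fun i j hij => ?_⟩
    · have : 0 ≤ C := hn i ▸ norm_nonneg _
      rw [norm_smul, hn]; simp [abs_of_nonneg this, hC]
    · simp [inner_smul_left, inner_smul_right, ho i j hij]
  -- Bessel's inequality: the squared coefficients are summable.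
  have := (hor.inner_products_summable y).tendsto_cofinite_zero
  rw [tendsto_zero_iff_norm_tendsto_zero]
  have h2 := (this.sqrt).const_mul |C|
  simp only [Real.sqrt_zero, mul_zero] at h2
  refine h2.congr fun i => ?_
  rw [Real.sqrt_sq (norm_nonneg _), inner_smul_left, norm_mul]
  simp [hC]

theorem tendsto_inner_zero_of_dense {ι : Type*} {l : Filter ι} {S : Set H} (hS : Dense S)
    {g : ι → H} {C : ℝ} (hg : ∀ i, ‖g i‖ ≤ C)
    (h : ∀ x ∈ S, Tendsto (fun i => inner ℂ x (g i)) l (𝓝 0)) (x : H) :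
    Tendsto (fun i => inner ℂ x (g i)) l (𝓝 0) := by
  rcases isEmpty_or_nonempty ι with _ | ⟨⟨i₀⟩⟩
  · simp [Filter.filter_eq_bot_of_isEmpty l]
  have hC : 0 ≤ C := (norm_nonneg _).trans (hg i₀)
  refine Metric.tendsto_nhds.2 fun δ hδ => ?_
  obtain ⟨x', hx', hd⟩ := hS.exists_dist_lt x (show 0 < δ / (2 * (C + 1)) by positivity)
  filter_upwards [Metric.tendsto_nhds.1 (h x' hx') (δ / 2) (by positivity)] with i hi
  rw [dist_zero_right] at hi ⊢
  have e : inner ℂ x (g i) = inner ℂ (x - x') (g i) + inner ℂ x' (g i) := by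
    rw [← inner_add_left, sub_add_cancel]
  have h1 : ‖inner ℂ (x - x') (g i)‖ ≤ δ / 2 := by
    refine (norm_inner_le_norm _ _).trans ?_
    rw [dist_eq_norm] at hd
    calc ‖x - x'‖ * ‖g i‖ ≤ δ / (2 * (C + 1)) * (C + 1) :=
          mul_le_mul hd.le ((hg i).trans (by linarith)) (norm_nonneg _) (by positivity)
      _ = δ / 2 := by field_simp
  rw [e]
  linarith [norm_add_le (inner ℂ (x - x') (g i)) (inner ℂ x' (g i))]

end Hilbert

/-! ### The trace on operators commuting with the right action. -/

namespace BiRep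

open Filter Topology

variable {Γ : Type*} [Group Γ] {τ : Γ → ℂ} {H : Type*} [NormedAddCommGroup H]
  [InnerProductSpace ℂ H] (B : BiRep τ H)

theorem lam_one (v : H) : B.lam 1 v = v :=
  (B.lam 1).injective (by rw [← B.lam_mul, one_mul])

theorem rho_one (v : H) : B.rho 1 v = v :=
  (B.rho 1).injective (by rw [← B.rho_mul, one_mul])

theorem lam_symm (g : Γ) (v : H) : (B.lam g).symm v = B.lam g⁻¹ v := by
  rw [LinearIsometryEquiv.symm_apply_eq, ← B.lam_mul, mul_inv_cancel, lam_one]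

theorem rho_symm (g : Γ) (v : H) : (B.rho g).symm v = B.rho g⁻¹ v := by
  rw [LinearIsometryEquiv.symm_apply_eq, ← B.rho_mul, mul_inv_cancel, rho_one]

theorem inner_lam_left (g : Γ) (v w : H) : inner ℂ (B.lam g v) w = inner ℂ v (B.lam g⁻¹ w) := by
  rw [← lam_symm, ← (B.lam g).inner_map_map v, LinearIsometryEquiv.apply_symm_apply]

theorem inner_rho_left (g : Γ) (v w : H) : inner ℂ (B.rho g v) w = inner ℂ v (B.rho g⁻¹ w) := by
  rw [← rho_symm, ← (B.rho g).inner_map_map v, LinearIsometryEquiv.apply_symm_apply]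

theorem lam_vec (g : Γ) : B.lam g B.vec = B.rho g⁻¹ B.vec := by
  rw [rho_vec, inv_inv]

theorem lam_rho_vec (g : Γ) : B.lam g (B.rho g B.vec) = B.vec := by
  rw [rho_vec, ← lam_mul, mul_inv_cancel, lam_one]

theorem eq_of_forall_inner_lam {v w : H}
    (h : ∀ g, inner ℂ v (B.lam g B.vec) = inner ℂ w (B.lam g B.vec)) : v = w := by
  refine B.dense.eq_of_inner_left ℂ fun x hx => ?_
  induction hx using Submodule.span_induction with
  | mem x hx => obtain ⟨g, rfl⟩ := hx; exact h g
  | zero => simp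
  | add x y _ _ hx hy => simp_all [inner_add_right]
  | smul c x _ hx => simp_all [inner_smul_right]

/-- Operators commuting with the right representation. -/
def IsRight (T : H →L[ℂ] H) : Prop := ∀ g v, T (B.rho g v) = B.rho g (T v)

/-- Subspaces invariant under the right representation. -/
def RightInvariant (K : Submodule ℂ H) : Prop := ∀ g, ∀ v ∈ K, B.rho g v ∈ K

variable {B}

theorem IsRight.one : B.IsRight 1 := fun _ _ => rfl

theorem IsRight.mul {S T : H →L[ℂ] H} (hS : B.IsRight S) (hT : B.IsRight T) :
    B.IsRight (S * T) := fun g v => by simp [hT g, hS g]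

theorem IsRight.sub {S T : H →L[ℂ] H} (hS : B.IsRight S) (hT : B.IsRight T) :
    B.IsRight (S - T) := fun g v => by simp [hT g, hS g]

theorem IsRight.pow {T : H →L[ℂ] H} (hT : B.IsRight T) (n : ℕ) : B.IsRight (T ^ n) := by
  induction n with
  | zero => simpa using IsRight.one
  | succ n ih => rw [pow_succ]; exact ih.mul hT

theorem IsRight.map_star [CompleteSpace H] {T : H →L[ℂ] H} (hT : B.IsRight T) :
    B.IsRight (star T) := fun g v => by
  refine ext_inner_right ℂ fun w => ?_
  simp only [ContinuousLinearMap.star_eq_adjoint]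
  rw [ContinuousLinearMap.adjoint_inner_left, inner_rho_left, inner_rho_left,
    ContinuousLinearMap.adjoint_inner_left, hT]

theorem RightInvariant.isRight {K : Submodule ℂ H} [K.HasOrthogonalProjection]
    (hK : B.RightInvariant K) : B.IsRight K.starProjection := fun g v =>
  starProjection_comm_of_invariant _ _ (hK g) (fun v hv => by rw [rho_symm]; exact hK _ v hv) v

/-- The vector is cyclic for the right action as well, hence separating for the operators commuting
with it. -/
theorem IsRight.eq_zero {T : H →L[ℂ] H} (hT : B.IsRight T) (h : T B.vec = 0) : T = 0 := by
  refine ContinuousLinearMap.coeFn_injective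
    (Continuous.ext_on B.dense T.continuous continuous_const fun x hx => ?_)
  induction hx using Submodule.span_induction with
  | mem x hx => obtain ⟨g, rfl⟩ := hx; simp [lam_vec, hT _ B.vec, h]
  | zero => simp
  | add x y _ _ hx hy => simp_all
  | smul c x _ hx => simp_all

variable [CompleteSpace H]

/-- This reduces the trace property to the antiunitarity of `flip`. -/
theorem IsRight.flip_apply {T : H →L[ℂ] H} (hT : B.IsRight T) :
    B.flip (T B.vec) = star T B.vec := by
  refine B.eq_of_forall_inner_lam fun g => ?_
  have : B.lam g B.vec = B.flip (B.lam g⁻¹ B.vec) := by rw [flip_vec, inv_inv]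
  rw [ContinuousLinearMap.star_eq_adjoint, ContinuousLinearMap.adjoint_inner_left, lam_vec, hT,
    ← lam_vec, this, inner_map_map_of_conj, ← rho_vec, inner_rho_left]

/-- The vector state of the cyclic vector is a trace. -/
theorem IsRight.inner_mul_comm {S T : H →L[ℂ] H} (hS : B.IsRight S) (hT : B.IsRight T) :
    inner ℂ B.vec ((S * T) B.vec) = inner ℂ B.vec ((T * S) B.vec) := by
  have h1 := hT.map_star.flip_apply
  rw [star_star] at h1
  calc inner ℂ B.vec (S (T B.vec))
      = inner ℂ (star S B.vec) (T B.vec) := (ContinuousLinearMap.adjoint_inner_left S _ _).symm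
    _ = inner ℂ (star T B.vec) (S B.vec) := by
      rw [← hS.flip_apply, ← h1, inner_map_map_of_conj]
    _ = inner ℂ B.vec (T (S B.vec)) := ContinuousLinearMap.adjoint_inner_left T _ _

/-- `T` intertwines 1 - T*T with 1 - TT*, so the terms by which consecutive powers differ have equal
traces. -/
theorem IsRight.inner_one_sub_star_mul_pow {T : H →L[ℂ] H} (hT : B.IsRight T) (n : ℕ) :
    inner ℂ B.vec (((1 - star T * T) ^ n) B.vec) =
      inner ℂ B.vec (((1 - T * star T) ^ n) B.vec) := by
  induction n with
  | zero => simp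
  | succ n ih =>
    have hc : T * (1 - star T * T) ^ n = (1 - T * star T) ^ n * T := by
      have : SemiconjBy T (1 - star T * T) (1 - T * star T) := by
        simp only [SemiconjBy]; noncomm_ring
      exact this.pow_right n
    have hr := (IsRight.one (B := B)).sub (hT.map_star.mul hT)
    rw [pow_succ, pow_succ, mul_sub, mul_sub, mul_one, mul_one, sub_apply,
      sub_apply, inner_sub_right, inner_sub_right, ih, ← mul_assoc,
      IsRight.inner_mul_comm ((hr.pow n).mul hT.map_star) hT, ← mul_assoc, hc, mul_assoc]

end BiRep

/-! ### Comparison and continuity of dimension. -/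

namespace BiRep

open Filter Topology

variable {Γ : Type*} [Group Γ] {τ : Γ → ℂ} {H : Type*} [NormedAddCommGroup H]
  [InnerProductSpace ℂ H] [CompleteSpace H] {B : BiRep τ H}

/-- Comparison of dimensions: if `K` meets the orthogonal complement of `U` trivially, the
dimension of `K` is at most that of `U`. -/
theorem norm_starProjection_vec_le {K U : Submodule ℂ H} [K.HasOrthogonalProjection]
    [U.HasOrthogonalProjection] (hK : B.RightInvariant K) (hU : B.RightInvariant U)
    (h : K ⊓ Uᗮ = ⊥) : ‖K.starProjection B.vec‖ ^ 2 ≤ ‖U.starProjection B.vec‖ ^ 2 := by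
  set r := K.starProjection with hr
  set z := U.starProjection with hz
  have rr : r * r = r := K.isIdempotentElem_starProjection
  have zz : z * z = z := U.isIdempotentElem_starProjection
  have rs : star r = r := isSelfAdjoint_starProjection K
  have zs : star z = z := isSelfAdjoint_starProjection U
  set T := z * r with hT
  have Tst : star T = r * z := by rw [hT, star_mul, rs, zs]
  have hTr : B.IsRight T := hU.isRight.mul hK.isRight
  set W := 1 - star T * T with hW
  set C := 1 - T * star T with hC
  have Cs : star C = C := by simp [hC]
  -- This makes `W` a contraction, and a vector fixed by its square must be killed by `T`.
  have hWn : ∀ x, ‖W x‖ ^ 2 ≤ ‖x‖ ^ 2 - ‖T x‖ ^ 2 := fun x => by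
    have h1 : W x = x - star T (T x) := rfl
    have h2 : ‖star T (T x)‖ ^ 2 ≤ ‖T x‖ ^ 2 := by
      have : star T (T x) = r (T x) := by
        change (star T * T) x = (r * T) x
        rw [Tst, hT, mul_assoc, ← mul_assoc z, zz]
      rw [this]
      gcongr
      exact K.norm_starProjection_apply_le _
    have h3 : RCLike.re (inner ℂ x (star T (T x))) = ‖T x‖ ^ 2 := by
      rw [ContinuousLinearMap.star_eq_adjoint, ContinuousLinearMap.adjoint_inner_right,
        inner_self_eq_norm_sq]
    rw [h1, @norm_sub_sq ℂ, h3]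
    linarith
  have hWle : ∀ x, ‖W x‖ ≤ ‖x‖ := fun x => by
    have := hWn x
    exact le_of_sq_le_sq (by nlinarith [sq_nonneg ‖T x‖]) (norm_nonneg _)
  have hf : ‖W * W‖ ≤ 1 := by
    refine ContinuousLinearMap.opNorm_le_bound _ zero_le_one fun x => ?_
    rw [one_mul]
    exact (hWle _).trans (hWle x)
  -- Mean ergodic theorem: the averages of powers of W² tend to the projection onto its fixed
  -- vectors, which lie in Kᗮ.
  have lim := ContinuousLinearMap.tendsto_birkhoffAverage_orthogonalProjection (W * W) hf B.vec
  set F := (W * W).eqLocus (1 : H →L[ℂ] H) with hF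
  have hFK : F ≤ Kᗮ := fun x hx => by
    have hx' : W (W x) = x := hx
    have h1 := hWn x
    have h2 : ‖x‖ ≤ ‖W x‖ := by
      conv_lhs => rw [← hx']
      exact hWle _
    have h3 : T x = 0 := by
      rw [← norm_eq_zero]
      have : ‖x‖ ^ 2 ≤ ‖W x‖ ^ 2 := by gcongr
      exact pow_eq_zero_iff (two_ne_zero) |>.1 (le_antisymm (by linarith) (sq_nonneg _))
    have h4 : r x ∈ K ⊓ Uᗮ :=
      ⟨K.starProjection_apply_mem x, U.starProjection_apply_eq_zero_iff.1 h3⟩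
    rw [h, Submodule.mem_bot] at h4
    exact K.starProjection_apply_eq_zero_iff.1 h4
  have e4 : ∀ n : ℕ, (1 - z) * C ^ n = 1 - z := fun n => by
    have : (1 - z) * C = 1 - z := by
      rw [hC, Tst, hT, mul_sub, mul_one, mul_assoc, sub_mul, one_mul, ← mul_assoc z z, zz,
        sub_self, sub_zero]
    induction n with
    | zero => simp
    | succ n ih => rw [pow_succ, ← mul_assoc, ih, this]
  -- The trace of W^(2n) equals that of C^(2n), which is ‖Cⁿξ‖² as `C` is self-adjoint; Cⁿξ has the
  -- same Uᗮ-component as ξ. Squaring `W` keeps the exponents even.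
  have key : ∀ n : ℕ, ‖B.vec‖ ^ 2 - ‖z B.vec‖ ^ 2 ≤
      RCLike.re (inner ℂ B.vec ((W * W)^[n] B.vec)) := fun n => by
    have e1 : (W * W)^[n] B.vec = (W ^ (2 * n)) B.vec := by
      rw [pow_mul, sq]; simp
    have e2 : C ^ (2 * n) = star (C ^ n) * C ^ n := by rw [star_pow, Cs, two_mul, pow_add]
    rw [e1, hW, hTr.inner_one_sub_star_mul_pow, ← hC, e2]
    have e3 : inner ℂ B.vec ((star (C ^ n) * C ^ n) B.vec) =
        inner ℂ ((C ^ n) B.vec) ((C ^ n) B.vec) :=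
      ContinuousLinearMap.adjoint_inner_right (C ^ n) _ _
    rw [e3, inner_self_eq_norm_sq]
    have e5 := U.norm_sq_eq_add_norm_sq_starProjection B.vec
    have e6 := U.norm_sq_eq_add_norm_sq_starProjection ((C ^ n) B.vec)
    have e7 : Uᗮ.starProjection ((C ^ n) B.vec) = Uᗮ.starProjection B.vec := by
      rw [Submodule.starProjection_orthogonal']
      exact congrArg (fun S : H →L[ℂ] H => S B.vec) (e4 n)
    rw [e7] at e6
    rw [← hz] at e5
    nlinarith [sq_nonneg ‖U.starProjection ((C ^ n) B.vec)‖]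
  have hlim2 : ‖B.vec‖ ^ 2 - ‖z B.vec‖ ^ 2 ≤
      RCLike.re (inner ℂ B.vec (F.starProjection B.vec)) := by
    refine ge_of_tendsto ((RCLike.continuous_re.tendsto _).comp
      (((continuous_const.inner continuous_id).tendsto _).comp lim)) ?_
    filter_upwards [eventually_gt_atTop 0] with n hn
    have hn' : (0 : ℝ) < n := Nat.cast_pos.2 hn
    have hre : RCLike.re (inner ℂ B.vec (birkhoffAverage ℂ (W * W) id n B.vec)) =
        (n : ℝ)⁻¹ * ∑ k ∈ Finset.range n, RCLike.re (inner ℂ B.vec ((W * W)^[k] B.vec)) := by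
      have hc : ((n : ℂ))⁻¹ = (((n : ℝ)⁻¹ : ℝ) : ℂ) := by push_cast; rfl
      simp only [birkhoffAverage, birkhoffSum, id, inner_smul_right, inner_sum, hc]
      simp
    change _ ≤ RCLike.re (inner ℂ B.vec (birkhoffAverage ℂ (W * W) id n B.vec))
    rw [hre, ← div_eq_inv_mul, le_div_iff₀ hn', mul_comm, ← nsmul_eq_mul]
    simpa using Finset.card_nsmul_le_sum (Finset.range n) _ _ fun k _ => key k
  have h1 : RCLike.re (inner ℂ B.vec (F.starProjection B.vec)) = ‖F.starProjection B.vec‖ ^ 2 := by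
    rw [← inner_conj_symm, RCLike.conj_re]
    exact F.re_inner_starProjection_eq_normSq B.vec
  have h2 : F.starProjection (Kᗮ.starProjection B.vec) = F.starProjection B.vec :=
    congrArg (fun S : H →L[ℂ] H => S B.vec)
      (Submodule.starProjection_comp_starProjection_of_le hFK)
  have h3 : ‖F.starProjection B.vec‖ ≤ ‖Kᗮ.starProjection B.vec‖ := by
    rw [← h2]; exact F.norm_starProjection_apply_le _
  have h4 := K.norm_sq_eq_add_norm_sq_starProjection B.vec
  have h5 : ‖F.starProjection B.vec‖ ^ 2 ≤ ‖Kᗮ.starProjection B.vec‖ ^ 2 := by gcongr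
  rw [← hr] at h4
  linarith

/-- Continuity of dimension: a nonzero subspace of the closure of an increasing union meets one of
the members nontrivially. -/
theorem exists_inf_ne_bot {K : Submodule ℂ H} [K.HasOrthogonalProjection] (L : ℕ → Submodule ℂ H)
    [∀ l, (L l).HasOrthogonalProjection] (hL : Monotone L) (hK : B.RightInvariant K)
    (hLr : ∀ l, B.RightInvariant (L l)) (hKL : K ≤ (⨆ l, L l).topologicalClosure) (h0 : K ≠ ⊥) :
    ∃ l, K ⊓ L l ≠ ⊥ := by
  by_contra! hcon
  set X := (⨆ l, L l).topologicalClosure with hX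
  have hLX : ∀ l, L l ≤ X := fun l => (le_iSup L l).trans (Submodule.le_topologicalClosure _)
  have hXr : B.RightInvariant X := fun g v hv =>
    closure_iSup_invariant (B.rho g) L (fun l => hLr l g) v hv
  -- A vector of K ≤ X orthogonal to X ⊓ (L l)ᗮ lies in L l, so the comparison applies with U = X ⊓
  -- (L l)ᗮ, whose dimension tends to zero.
  have bound : ∀ l, ‖K.starProjection B.vec‖ ≤
      ‖X.starProjection B.vec - (L l).starProjection B.vec‖ := fun l => by
    have hUc : IsClosed ((X ⊓ (L l)ᗮ : Submodule ℂ H) : Set H) :=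
      (Submodule.isClosed_topologicalClosure _).inter (L l).isClosed_orthogonal
    have : CompleteSpace (X ⊓ (L l)ᗮ : Submodule ℂ H) := hUc.completeSpace_coe
    have hUr : B.RightInvariant (X ⊓ (L l)ᗮ) := fun g v hv => by
      refine ⟨hXr g v hv.1, (Submodule.mem_orthogonal _ _).2 fun u hu => ?_⟩
      rw [← inv_inv g, ← inner_rho_left]
      exact (Submodule.mem_orthogonal _ _).1 hv.2 _ (hLr l _ u hu)
    have hKU : K ⊓ (X ⊓ (L l)ᗮ)ᗮ = ⊥ := by
      refine eq_bot_iff.2 fun v hv => ?_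
      rw [← hcon l]
      refine ⟨hv.1, ?_⟩
      have hm : v - (L l).starProjection v ∈ X ⊓ (L l)ᗮ :=
        ⟨Submodule.sub_mem _ (hKL hv.1) (hLX l ((L l).starProjection_apply_mem v)),
          (L l).sub_starProjection_mem_orthogonal v⟩
      have h1 : inner ℂ (v - (L l).starProjection v) v = 0 :=
        (Submodule.mem_orthogonal _ _).1 hv.2 _ hm
      have h2 : inner ℂ (v - (L l).starProjection v) ((L l).starProjection v) = 0 :=
        (L l).starProjection_inner_eq_zero v _ ((L l).starProjection_apply_mem v)
      have h3 : v - (L l).starProjection v = 0 := by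
        rw [← inner_self_eq_zero (𝕜 := ℂ), inner_sub_right, h1, h2, sub_zero]
      rw [sub_eq_zero.1 h3]
      exact (L l).starProjection_apply_mem v
    refine (abs_le_of_sq_le_sq' (norm_starProjection_vec_le hK hUr hKU) (norm_nonneg _)).2.trans ?_
    have e1 : (X ⊓ (L l)ᗮ).starProjection B.vec = (X ⊓ (L l)ᗮ).starProjection
        (X.starProjection B.vec - (L l).starProjection B.vec) := by
      rw [map_sub]
      have e2 : (X ⊓ (L l)ᗮ).starProjection (X.starProjection B.vec) =
          (X ⊓ (L l)ᗮ).starProjection B.vec := congrArg (fun S : H →L[ℂ] H => S B.vec)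
            (Submodule.starProjection_comp_starProjection_of_le inf_le_left)
      have e3 : (X ⊓ (L l)ᗮ).starProjection ((L l).starProjection B.vec) = 0 := by
        rw [Submodule.starProjection_apply_eq_zero_iff]
        exact Submodule.orthogonal_le inf_le_right
          (Submodule.le_orthogonal_orthogonal _ ((L l).starProjection_apply_mem _))
      rw [e2, e3, sub_zero]
    rw [e1]
    exact Submodule.norm_starProjection_apply_le _ _
  have hlim := Submodule.starProjection_tendsto_closure_iSup L hL B.vec
  have hlim2 := (tendsto_const_nhds (x := X.starProjection B.vec)).sub hlim
  rw [sub_self] at hlim2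
  have h1 := ge_of_tendsto' hlim2.norm bound
  rw [norm_zero] at h1
  have h2 := hK.isRight.eq_zero (norm_le_zero_iff.1 h1)
  refine h0 (eq_bot_iff.2 fun v hv => ?_)
  have h3 := K.starProjection_eq_self_iff.2 hv
  rw [h2] at h3
  exact h3.symm

end BiRep

/-! ### Fixed vectors of subgroups and displacement. -/

namespace BiRep

open Filter Topology

variable {Γ : Type*} [Group Γ] {τ : Γ → ℂ} {H : Type*} [NormedAddCommGroup H]
  [InnerProductSpace ℂ H] {B : BiRep τ H}

/-- The vectors fixed by a subgroup acting on the left. -/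
def fixed (B : BiRep τ H) (S : Subgroup Γ) : Submodule ℂ H where
  carrier := {v | ∀ g ∈ S, B.lam g v = v}
  add_mem' hv hw g hg := by rw [map_add, hv g hg, hw g hg]
  zero_mem' g _ := map_zero _
  smul_mem' c v hv g hg := by rw [map_smul, hv g hg]

theorem mem_fixed {S : Subgroup Γ} {v : H} : v ∈ B.fixed S ↔ ∀ g ∈ S, B.lam g v = v := Iff.rfl

theorem isClosed_fixed (S : Subgroup Γ) : IsClosed (B.fixed S : Set H) := by
  have : (B.fixed S : Set H) = ⋂ g ∈ S, {v | B.lam g v = v} := by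
    ext v; simp [mem_fixed]
  rw [this]
  exact isClosed_biInter fun g _ => isClosed_eq (B.lam g).continuous continuous_id

theorem rightInvariant_fixed (S : Subgroup Γ) : B.RightInvariant (B.fixed S) :=
  fun g v hv s hs => by
  rw [lam_rho, hv s hs]

theorem fixed_anti {S T : Subgroup Γ} (h : S ≤ T) : B.fixed T ≤ B.fixed S :=
  fun _ hv g hg => hv g (h hg)

theorem lam_mem_fixed {S : Subgroup Γ} {g : Γ} (hg : g ∈ Subgroup.normalizer (S : Set Γ)) {v : H}
    (hv : v ∈ B.fixed S) : B.lam g v ∈ B.fixed S := fun s hs => by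
  have h1 : g⁻¹ * s * g ∈ S := by
    have := (Subgroup.mem_normalizer_iff.1 (inv_mem hg) s).1 hs
    rwa [inv_inv] at this
  have h2 : s * g = g * (g⁻¹ * s * g) := by group
  rw [← lam_mul, h2, lam_mul, hv _ h1]

theorem mem_fixed_sup {S T : Subgroup Γ} {v : H} (hS : v ∈ B.fixed S) (hT : v ∈ B.fixed T) :
    v ∈ B.fixed (S ⊔ T) := by
  let stab : Subgroup Γ :=
    { carrier := {g | B.lam g v = v}
      one_mem' := lam_one _ _
      mul_mem' := fun {a b} ha hb => by
        change B.lam (a * b) v = v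
        rw [lam_mul]
        exact (congrArg (B.lam a) hb).trans ha
      inv_mem' := fun {a} ha => by
        change B.lam a⁻¹ v = v
        rw [← lam_symm, LinearIsometryEquiv.symm_apply_eq]
        exact (show B.lam a v = v from ha).symm }
  exact fun g hg => (sup_le (c := stab) hS hT) hg

/-- The closure of the union of the spaces of vectors fixed by the members of a sequence of
subgroups. -/
def fixedLimit (B : BiRep τ H) (V : ℕ → Subgroup Γ) : Submodule ℂ H :=
  (⨆ l, B.fixed (V l)).topologicalClosure

theorem fixed_le_fixedLimit (V : ℕ → Subgroup Γ) (l : ℕ) : B.fixed (V l) ≤ B.fixedLimit V :=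
  (le_iSup (fun l => B.fixed (V l)) l).trans (Submodule.le_topologicalClosure _)

theorem rightInvariant_fixedLimit (V : ℕ → Subgroup Γ) : B.RightInvariant (B.fixedLimit V) :=
  fun g => closure_iSup_invariant (B.rho g) _ fun l => rightInvariant_fixed (V l) g

theorem lam_mem_fixedLimit {V : ℕ → Subgroup Γ} {g : Γ}
    (hg : ∀ l, g ∈ Subgroup.normalizer (V l : Set Γ)) :
    ∀ v ∈ B.fixedLimit V, B.lam g v ∈ B.fixedLimit V :=
  closure_iSup_invariant (B.lam g) _ fun l _ hv => lam_mem_fixed (hg l) hv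

theorem isClosed_fixedLimit (V : ℕ → Subgroup Γ) : IsClosed (B.fixedLimit V : Set H) :=
  Submodule.isClosed_topologicalClosure _

theorem starProjection_lam {X : Submodule ℂ H} [X.HasOrthogonalProjection] {g : Γ}
    (h1 : ∀ v ∈ X, B.lam g v ∈ X) (h2 : ∀ v ∈ X, B.lam g⁻¹ v ∈ X) (v : H) :
    X.starProjection (B.lam g v) = B.lam g (X.starProjection v) :=
  starProjection_comm_of_invariant _ _ h1 (fun v hv => by rw [lam_symm]; exact h2 v hv) v

variable [CompleteSpace H]

instance (S : Subgroup Γ) : CompleteSpace (B.fixed S) := (isClosed_fixed S).completeSpace_coe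

instance (V : ℕ → Subgroup Γ) : CompleteSpace (B.fixedLimit V) :=
  (isClosed_fixedLimit V).completeSpace_coe

theorem starProjection_fixedLimit_lam {V : ℕ → Subgroup Γ} {g : Γ}
    (hg : ∀ l, g ∈ Subgroup.normalizer (V l : Set Γ)) (v : H) :
    (B.fixedLimit V).starProjection (B.lam g v) = B.lam g ((B.fixedLimit V).starProjection v) :=
  starProjection_lam (lam_mem_fixedLimit hg) (lam_mem_fixedLimit fun l => inv_mem (hg l)) v

theorem orthogonal_starProjection_fixedLimit_lam {V : ℕ → Subgroup Γ} {g : Γ}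
    (hg : ∀ l, g ∈ Subgroup.normalizer (V l : Set Γ)) (v : H) :
    (B.fixedLimit V)ᗮ.starProjection (B.lam g v) =
      B.lam g ((B.fixedLimit V)ᗮ.starProjection v) := by
  simp only [Submodule.starProjection_orthogonal_val, starProjection_fixedLimit_lam hg, map_sub]

theorem isRight_orthogonal_fixedLimit (V : ℕ → Subgroup Γ) :
    B.IsRight (B.fixedLimit V)ᗮ.starProjection := fun g v => by
  simp only [Submodule.starProjection_orthogonal_val, map_sub,
    (rightInvariant_fixedLimit V).isRight g]

/-- If `η` is orthogonal to the `S`-fixed vectors and the inner product with `ζ` is constant on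
the `S`-orbit of `η`, it is zero. -/
theorem inner_eq_zero_of_inner_lam_eq {S : Subgroup Γ} {η ζ : H}
    (hη : η ∈ (B.fixed S)ᗮ) (h : ∀ s ∈ S, inner ℂ (B.lam s η) ζ = inner ℂ η ζ) :
    inner ℂ η ζ = 0 := by
  -- The component of η in Kᗮ is S-fixed, hence zero, whereas ζ lies in Kᗮ.
  let K := Submodule.span ℂ {w | ∃ s ∈ S, w = B.lam s η - η}
  have hK : ∀ s ∈ S, ∀ v ∈ K, B.lam s v ∈ K := fun s hs v hv => by
    induction hv using Submodule.span_induction with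
    | mem x hx =>
      obtain ⟨t, ht, rfl⟩ := hx
      have e : B.lam s (B.lam t η - η) = (B.lam (s * t) η - η) - (B.lam s η - η) := by
        rw [map_sub, lam_mul]; abel
      rw [e]
      exact K.sub_mem (Submodule.subset_span ⟨_, mul_mem hs ht, rfl⟩)
        (Submodule.subset_span ⟨_, hs, rfl⟩)
    | zero => rw [map_zero]; exact K.zero_mem
    | add x y _ _ hx hy => rw [map_add]; exact K.add_mem hx hy
    | smul c x _ hx => rw [map_smul]; exact K.smul_mem c hx
  have hKo : ∀ s ∈ S, ∀ v ∈ Kᗮ, B.lam s v ∈ Kᗮ := fun s hs v hv => by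
    refine (Submodule.mem_orthogonal _ _).2 fun u hu => ?_
    rw [← inv_inv s, ← inner_lam_left]
    exact (Submodule.mem_orthogonal _ _).1 hv _ (hK _ (inv_mem hs) u hu)
  have hfix : Kᗮ.starProjection η ∈ B.fixed S := fun s hs => by
    rw [← starProjection_lam (hKo s hs) (hKo _ (inv_mem hs)), ← sub_eq_zero, ← map_sub,
      Submodule.starProjection_apply_eq_zero_iff]
    exact Submodule.le_orthogonal_orthogonal _ (Submodule.subset_span ⟨s, hs, rfl⟩)
  have h0 : Kᗮ.starProjection η = 0 := by
    have h1 := (Submodule.mem_orthogonal _ _).1 hη _ hfix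
    have h2 := Kᗮ.re_inner_starProjection_eq_normSq η
    rw [h1] at h2
    simpa using h2.symm
  have hζ : ζ ∈ Kᗮ := by
    refine (Submodule.mem_orthogonal _ _).2 fun u hu => ?_
    induction hu using Submodule.span_induction with
    | mem x hx => obtain ⟨s, hs, rfl⟩ := hx; rw [inner_sub_left, h s hs, sub_self]
    | zero => simp
    | add x y _ _ hx hy => rw [inner_add_left, hx, hy, add_zero]
    | smul c x _ hx => rw [inner_smul_left, hx, mul_zero]
  rw [← inner_conj_symm]
  rw [Submodule.starProjection_apply_eq_zero_iff] at h0
  rw [(Submodule.mem_orthogonal _ _).1 h0 _ hζ, map_zero]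

/-- Displacement of `d` by `V`: for some `l` each element of `V l * d` is a conjugate of `d` under
an element normalizing every member of `V`. -/
def Displaces (V : ℕ → Subgroup Γ) (d : Γ) : Prop :=
  ∃ l, ∀ s ∈ V l, ∃ u, (∀ m, u ∈ Subgroup.normalizer (V m : Set Γ)) ∧ u * d * u⁻¹ = s * d

/-- Conjugation by u fixes ξ and, when u normalizes every V m, also its component η off the limit
space. Applied to the u carrying d to s⁻¹d, this shows that ⟨sη, dξ⟩ does not depend on s in V l. -/
theorem inner_lam_vec_eq_zero {V : ℕ → Subgroup Γ} {d : Γ} (hd : Displaces V d) :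
    inner ℂ ((B.fixedLimit V)ᗮ.starProjection B.vec) (B.lam d B.vec) = 0 := by
  obtain ⟨l, hl⟩ := hd
  refine inner_eq_zero_of_inner_lam_eq (B := B) (S := V l)
    (Submodule.orthogonal_le (fixed_le_fixedLimit V l) (Submodule.starProjection_apply_mem _ _))
    fun s hs => ?_
  obtain ⟨u, hu, hus⟩ := hl s⁻¹ (inv_mem hs)
  have h1 : B.lam s⁻¹ (B.lam d B.vec) = B.lam u (B.rho u (B.lam d B.vec)) := by
    rw [← lam_mul, ← hus, lam_mul, lam_mul, lam_vec, inv_inv, lam_rho]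
  have hr := isRight_orthogonal_fixedLimit (B := B) V
  have h2 : B.lam u (B.rho u ((B.fixedLimit V)ᗮ.starProjection B.vec)) =
      (B.fixedLimit V)ᗮ.starProjection B.vec := by
    rw [← hr, ← orthogonal_starProjection_fixedLimit_lam hu, lam_rho_vec]
  rw [inner_lam_left, h1]
  conv_lhs => rw [← h2]
  rw [LinearIsometryEquiv.inner_map_map, LinearIsometryEquiv.inner_map_map]

theorem tendsto_inner_lam_vec {ι : Type*} {V : ℕ → Subgroup Γ} {d : ι → Γ}
    (hdV : ∀ i m, d i ∈ Subgroup.normalizer (V m : Set Γ))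
    (hd : ∀ i j, i ≠ j → Displaces V ((d j)⁻¹ * d i)) (y : H) :
    Tendsto (fun i => inner ℂ (B.lam (d i) ((B.fixedLimit V)ᗮ.starProjection B.vec)) y)
      cofinite (𝓝 0) := by
  refine tendsto_inner_zero_of_orthogonal _ ‖(B.fixedLimit V)ᗮ.starProjection B.vec‖
    (fun i => LinearIsometryEquiv.norm_map _ _) (fun i j hij => ?_) y
  have hn : ∀ m, (d i)⁻¹ * d j ∈ Subgroup.normalizer (V m : Set Γ) := fun m =>
    mul_mem (inv_mem (hdV i m)) (hdV j m)
  rw [inner_lam_left, ← lam_mul, ← orthogonal_starProjection_fixedLimit_lam hn,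
    ← Submodule.inner_starProjection_left_eq_right,
    (B.fixedLimit V)ᗮ.starProjection_eq_self_iff.2 (Submodule.starProjection_apply_mem _ _)]
  exact inner_lam_vec_eq_zero (hd j i hij.symm)

/-- The right translates of ξ span a dense subspace, and the right action commutes with the
projection and with `d i`, so the case of ξ suffices. -/
theorem tendsto_inner_lam {ι : Type*} {V : ℕ → Subgroup Γ} {d : ι → Γ}
    (hdV : ∀ i m, d i ∈ Subgroup.normalizer (V m : Set Γ))
    (hd : ∀ i j, i ≠ j → Displaces V ((d j)⁻¹ * d i)) (ζ y : H) :
    Tendsto (fun i => inner ℂ (B.lam (d i) ((B.fixedLimit V)ᗮ.starProjection ζ)) y)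
      cofinite (𝓝 0) := by
  have e : ∀ ζ i, inner ℂ (B.lam (d i) ((B.fixedLimit V)ᗮ.starProjection ζ)) y =
      inner ℂ ζ ((B.fixedLimit V)ᗮ.starProjection (B.lam (d i)⁻¹ y)) := fun ζ i => by
    rw [inner_lam_left, Submodule.inner_starProjection_left_eq_right]
  simp only [e]
  refine tendsto_inner_zero_of_dense B.dense (C := ‖y‖) (fun i => ?_) (fun x hx => ?_) ζ
  · exact (Submodule.norm_starProjection_apply_le _ _).trans (LinearIsometryEquiv.norm_map _ _).le
  · have hr := isRight_orthogonal_fixedLimit (B := B) V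
    induction hx using Submodule.span_induction with
    | mem x hx =>
      obtain ⟨g, rfl⟩ := hx
      refine (tendsto_inner_lam_vec (B := B) hdV hd (B.rho g y)).congr fun i => ?_
      beta_reduce
      rw [← e, lam_vec, hr, lam_rho, inner_rho_left, inv_inv]
    | zero => simpa using tendsto_const_nhds
    | add x y _ _ hx hy => simpa only [inner_add_left, add_zero] using hx.add hy
    | smul c x _ hx => simpa only [inner_smul_left, mul_zero] using hx.const_mul ((starRingEnd ℂ) c)

end BiRep

/-! ### Producing common fixed vectors, and the use of extremality. -/

namespace BiRep

open Filter Topology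

variable {Γ : Type*} [Group Γ] {τ : Γ → ℂ} {H : Type*} [NormedAddCommGroup H]
  [InnerProductSpace ℂ H]

/-- The projected vector is still fixed by conjugation, and the sums testing positivity are squared
norms of combinations of its translates. -/
theorem isCharacter_inner_starProjection (B : BiRep τ H) (K : Submodule ℂ H)
    [K.HasOrthogonalProjection] (hr : B.IsRight K.starProjection)
    (hl : ∀ g v, K.starProjection (B.lam g v) = B.lam g (K.starProjection v)) :
    IsCharacter fun g => inner ℂ B.vec (B.lam g (K.starProjection B.vec)) := by
  constructor
  · intro n c g
    have : ∑ i, ∑ j, c i * (starRingEnd ℂ) (c j) *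
        inner ℂ B.vec (B.lam ((g j)⁻¹ * g i) (K.starProjection B.vec)) =
        inner ℂ (∑ j, c j • B.lam (g j) (K.starProjection B.vec))
          (∑ i, c i • B.lam (g i) (K.starProjection B.vec)) := by
      simp only [sum_inner, inner_sum, inner_smul_left, inner_smul_right, Finset.mul_sum]
      refine Finset.sum_congr rfl fun i _ => Finset.sum_congr rfl fun j _ => ?_
      have : inner ℂ (B.lam (g j) (K.starProjection B.vec)) (B.lam (g i) (K.starProjection B.vec)) =
          inner ℂ B.vec (B.lam ((g j)⁻¹ * g i) (K.starProjection B.vec)) := by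
        rw [inner_lam_left, ← lam_mul, Submodule.inner_starProjection_left_eq_right, ← hl]
        rw [Submodule.starProjection_eq_self_iff.2 (Submodule.starProjection_apply_mem _ _), hl]
      rw [this]; ring
    rw [this]
    exact RCLike.nonneg_iff.2 ⟨inner_self_nonneg, inner_self_im _⟩
  · intro g h
    have e1 : B.lam (h * g * h⁻¹) (K.starProjection B.vec) =
        B.lam h (B.rho h (B.lam g (K.starProjection B.vec))) := by
      rw [lam_mul, lam_mul, ← hl h⁻¹, lam_vec, inv_inv, hr, lam_rho]
    have e2 : ∀ x, inner ℂ B.vec (B.lam h (B.rho h x)) = inner ℂ B.vec x := fun x => by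
      conv_lhs => rw [← B.lam_rho_vec h]
      rw [LinearIsometryEquiv.inner_map_map, LinearIsometryEquiv.inner_map_map]
    rw [e1, e2]

variable [CompleteSpace H]

/-- If `τ` does not vanish at infinity along `d`, then there is a nonzero vector fixed by a member
of each of two sequences of subgroups displacing the quotients of `d` and of a nearby family. -/
theorem exists_fixed (B : BiRep τ H) {ι : Type*} [Infinite ι] {V W : ℕ → Subgroup Γ}
    (hV : Antitone V) (hW : Antitone W) {a d : ι → Γ}
    (hdV : ∀ i m, d i ∈ Subgroup.normalizer (V m : Set Γ))
    (haV : ∀ i m, a i ∈ Subgroup.normalizer (V m : Set Γ))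
    (haW : ∀ i m, a i ∈ Subgroup.normalizer (W m : Set Γ))
    (hd : ∀ i j, i ≠ j → Displaces V ((d j)⁻¹ * d i))
    (ha : ∀ i j, i ≠ j → Displaces W ((a j)⁻¹ * a i))
    (hfin : ∀ m, ∃ C : Set Γ, C.Finite ∧ (∀ c ∈ C, c ∈ Subgroup.normalizer (V m : Set Γ)) ∧
      ∀ i, ∃ c ∈ C, (a i * c)⁻¹ * d i ∈ V m)
    {ε : ℝ} (hε : 0 < ε) (hτ : ∀ i, ε ≤ ‖τ (d i)‖) :
    ∃ l, ∃ v ≠ 0, v ∈ B.fixed (V l) ∧ v ∈ B.fixed (W l) := by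
  set X := B.fixedLimit V
  set Y := B.fixedLimit W
  set ξ := B.vec with hξ
  let F := hyperfilter ι
  have hF : (F : Filter ι) ≤ cofinite := hyperfilter_le_cofinite
  obtain ⟨m, hm⟩ : ∃ m, ‖X.starProjection ξ - (B.fixed (V m)).starProjection ξ‖ * ‖ξ‖ < ε / 4 := by
    have h1 := Submodule.starProjection_tendsto_closure_iSup (fun l => B.fixed (V l))
      (fun i j hij => fixed_anti (hV hij)) ξ
    have h2 := (((tendsto_const_nhds (x := X.starProjection ξ)).sub h1).norm).mul_const ‖ξ‖
    have h3 : ‖X.starProjection ξ - X.starProjection ξ‖ * ‖ξ‖ < ε / 4 := by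
      rw [sub_self, norm_zero, zero_mul]; positivity
    exact (h2.eventually (gt_mem_nhds h3)).exists
  set p := (B.fixed (V m)).starProjection with hp
  have hpm : p ξ ∈ B.fixed (V m) := Submodule.starProjection_apply_mem _ _
  -- The Xᗮ-part and the approximation of the X-part by p ξ cost at most ε/4 each.
  have hbig : ∀ᶠ i in F, ε / 2 ≤ ‖inner ℂ (B.lam (d i) (p ξ)) ξ‖ := by
    have h1 := ((tendsto_inner_lam_vec (B := B) hdV hd ξ).mono_left hF).norm
    rw [norm_zero] at h1
    filter_upwards [h1.eventually (gt_mem_nhds (show (0 : ℝ) < ε / 4 by positivity))] with i hi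
    have e1 : inner ℂ (B.lam (d i) ξ) ξ = inner ℂ (B.lam (d i) (Xᗮ.starProjection ξ)) ξ +
        inner ℂ (B.lam (d i) (X.starProjection ξ - p ξ)) ξ + inner ℂ (B.lam (d i) (p ξ)) ξ := by
      rw [← inner_add_left, ← inner_add_left, ← map_add, ← map_add,
        Submodule.starProjection_orthogonal_val]
      congr 2; abel
    have e2 : ‖inner ℂ (B.lam (d i) (X.starProjection ξ - p ξ)) ξ‖ ≤ ε / 4 := by
      refine (norm_inner_le_norm _ _).trans ?_
      rw [LinearIsometryEquiv.norm_map]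
      exact hm.le
    have e3 := hτ i
    rw [← B.inner_vec, norm_inner_symm, ← hξ, e1] at e3
    have e4 := norm_add₃_le (a := inner ℂ (B.lam (d i) (Xᗮ.starProjection ξ)) ξ)
      (b := inner ℂ (B.lam (d i) (X.starProjection ξ - p ξ)) ξ)
      (c := inner ℂ (B.lam (d i) (p ξ)) ξ)
    linarith
  obtain ⟨C, hCf, hCn, hC⟩ := hfin m
  -- An ultrafilter selects one of finitely many representatives, so d i acts on p ξ as a i * c for
  -- F-almost all i.
  obtain ⟨c, hcC, hc⟩ := (Ultrafilter.eventually_exists_mem_iff (f := F) hCf).1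
    (Filter.univ_mem' hC)
  set ζ := B.lam c (p ξ)
  have hζ : ζ ∈ B.fixed (V m) := lam_mem_fixed (hCn c hcC) hpm
  obtain ⟨w, hw⟩ := exists_weak_limit F (fun i => B.lam (a i) ζ) ‖ζ‖
    (fun i => (LinearIsometryEquiv.norm_map _ _).le)
  have hw0 : w ≠ 0 := by
    rintro rfl
    have h1 := (hw ξ).norm
    rw [inner_zero_left, norm_zero] at h1
    have h2 : ε / 2 ≤ 0 := by
      refine ge_of_tendsto h1 ?_
      filter_upwards [hbig, hc] with i hi hci
      have : B.lam (d i) (p ξ) = B.lam (a i) ζ := by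
        conv_lhs => rw [show d i = a i * c * ((a i * c)⁻¹ * d i) by group]
        rw [lam_mul, hpm _ hci, lam_mul]
      rwa [this] at hi
    linarith
  have hwV : w ∈ B.fixed (V m) := by
    rw [← (B.fixed (V m)).orthogonal_orthogonal, Submodule.mem_orthogonal']
    intro y hy
    refine tendsto_nhds_unique (hw y) (tendsto_const_nhds.congr fun i => ?_)
    exact ((Submodule.mem_orthogonal _ _).1 hy _ (lam_mem_fixed (haV i m) hζ)).symm
  -- Against y in Yᗮ only the Yᗮ-part of ζ contributes, and its `a i`-translates tend weakly to
  -- zero.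
  have hwY : w ∈ Y := by
    rw [← Y.orthogonal_orthogonal, Submodule.mem_orthogonal']
    intro y hy
    refine tendsto_nhds_unique (hw y)
      (((tendsto_inner_lam (B := B) haW ha ζ y).mono_left hF).congr fun i => ?_)
    rw [Submodule.starProjection_orthogonal_val, map_sub, inner_sub_left, sub_eq_self]
    exact (Submodule.mem_orthogonal _ _).1 hy _
      (lam_mem_fixedLimit (haW i) _ (Submodule.starProjection_apply_mem _ _))
  have hcl : IsClosed ((B.fixed (V m) ⊓ Y : Submodule ℂ H) : Set H) :=
    (isClosed_fixed _).inter (isClosed_fixedLimit _)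
  have : CompleteSpace (B.fixed (V m) ⊓ Y : Submodule ℂ H) := hcl.completeSpace_coe
  obtain ⟨l, hl⟩ := exists_inf_ne_bot (B := B) (K := B.fixed (V m) ⊓ Y) (fun l => B.fixed (W l))
    (fun i j hij => fixed_anti (hW hij))
    (fun g v hv => ⟨rightInvariant_fixed _ g v hv.1, rightInvariant_fixedLimit _ g v hv.2⟩)
    (fun l => rightInvariant_fixed _) inf_le_right
    (fun h => hw0 ((Submodule.mem_bot ℂ).1 (h ▸ ⟨hwV, hwY⟩)))
  obtain ⟨v, hv, hv0⟩ := Submodule.exists_mem_ne_zero_of_ne_bot hl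
  exact ⟨max m l, v, hv0, fixed_anti (hV (le_max_left _ _)) hv.1.1,
    fixed_anti (hW (le_max_right _ _)) hv.2⟩

/-- For an extremal character a normal subgroup with a nonzero fixed vector fixes the cyclic
vector. -/
theorem vec_mem_fixed_of_extremal (B : BiRep τ H) (hτ : IsExtremalCharacter τ) {N : Subgroup Γ}
    (hN : N.Normal) (h0 : B.fixed N ≠ ⊥) : B.vec ∈ B.fixed N := by
  set K := B.fixed N with hK
  have hnorm : ∀ g, g ∈ Subgroup.normalizer (N : Set Γ) := fun g => by
    rw [Subgroup.normalizer_eq_top]; trivial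
  have hr : B.IsRight K.starProjection := (rightInvariant_fixed N).isRight
  have hl : ∀ g v, K.starProjection (B.lam g v) = B.lam g (K.starProjection v) := fun g v =>
    starProjection_lam (fun v hv => lam_mem_fixed (hnorm g) hv)
      (fun v hv => lam_mem_fixed (hnorm _) hv) v
  have hr' : B.IsRight Kᗮ.starProjection := fun g v => by
    simp only [Submodule.starProjection_orthogonal_val, map_sub, hr g]
  have hl' : ∀ g v, Kᗮ.starProjection (B.lam g v) = B.lam g (Kᗮ.starProjection v) := fun g v => by
    simp only [Submodule.starProjection_orthogonal_val, map_sub, hl g]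
  have hτ1 : τ 1 = 1 := hτ.1.2
  have hξ : ‖B.vec‖ ^ 2 = 1 := by
    have := B.inner_vec 1
    rw [lam_one, hτ1] at this
    rw [← inner_self_eq_norm_sq (𝕜 := ℂ), this, RCLike.one_re]
  have hpy := K.norm_sq_eq_add_norm_sq_starProjection B.vec
  rw [hξ] at hpy
  have inner_self' : ∀ (L : Submodule ℂ H) [L.HasOrthogonalProjection],
      inner ℂ B.vec (L.starProjection B.vec) = ((‖L.starProjection B.vec‖ ^ 2 : ℝ) : ℂ) := by
    intro L _
    have h1 : L.starProjection B.vec = L.starProjection (L.starProjection B.vec) :=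
      (Submodule.starProjection_eq_self_iff.2 (Submodule.starProjection_apply_mem _ _)).symm
    rw [h1, ← Submodule.inner_starProjection_left_eq_right, ← h1, inner_self_eq_norm_sq_to_K]
    push_cast; rfl
  have norm_char : ∀ (L : Submodule ℂ H) [L.HasOrthogonalProjection],
      B.IsRight L.starProjection →
      (∀ g v, L.starProjection (B.lam g v) = B.lam g (L.starProjection v)) →
      0 < ‖L.starProjection B.vec‖ ^ 2 →
      (fun g => (((‖L.starProjection B.vec‖ ^ 2)⁻¹ : ℝ) : ℂ) *
        inner ℂ B.vec (B.lam g (L.starProjection B.vec))) ∈ normalizedCharacters Γ := by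
    intro L _ h1 h2 h3
    have hc := isCharacter_inner_starProjection B L h1 h2
    refine ⟨⟨fun n c g => ?_, fun g h => ?_⟩, ?_⟩
    · have := mul_nonneg (Complex.zero_le_real.2 (inv_nonneg.2 h3.le)) (hc.posDef n c g)
      rw [Finset.mul_sum] at this
      simp only [Finset.mul_sum] at this
      refine this.trans_eq (Finset.sum_congr rfl fun i _ => Finset.sum_congr rfl fun j _ => ?_)
      ring
    · have := hc.conj_inv g h
      exact congrArg _ this
    · simp only [lam_one]
      rw [inner_self', ← Complex.ofReal_mul, inv_mul_cancel₀ h3.ne', Complex.ofReal_one]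
  by_cases hs : Kᗮ.starProjection B.vec = 0
  · rw [Submodule.starProjection_orthogonal_val, sub_eq_zero] at hs
    rw [hs]
    exact Submodule.starProjection_apply_mem _ _
  have ht : K.starProjection B.vec ≠ 0 := fun h => by
    have h2 := hr.eq_zero h
    refine h0 (eq_bot_iff.2 fun v hv => ?_)
    have h3 := K.starProjection_eq_self_iff.2 hv
    rw [h2] at h3
    exact h3.symm
  have ht' : 0 < ‖K.starProjection B.vec‖ ^ 2 := by positivity
  have hs' : 0 < ‖Kᗮ.starProjection B.vec‖ ^ 2 := by positivity
  -- By Pythagoras the squared norms of the two components are the weights of a convex decomposition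
  -- of `τ`.
  have heq := hτ.2 (norm_char K hr hl ht') (norm_char Kᗮ hr' hl' hs')
    ⟨_, _, ht', hs', hpy.symm, by
      ext g
      simp only [Pi.add_apply, Pi.smul_apply, Complex.real_smul]
      rw [← mul_assoc, ← mul_assoc, ← Complex.ofReal_mul, ← Complex.ofReal_mul,
        mul_inv_cancel₀ ht'.ne', mul_inv_cancel₀ hs'.ne', Complex.ofReal_one, one_mul, one_mul,
        ← inner_add_right, ← map_add, Submodule.starProjection_orthogonal_val,
        add_sub_cancel, B.inner_vec]⟩
  -- Equality of the characters says that both sides have the same inner products with the total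
  -- family of translates of ξ.
  have hp : K.starProjection B.vec = ((‖K.starProjection B.vec‖ ^ 2 : ℝ) : ℂ) • B.vec := by
    refine B.eq_of_forall_inner_lam fun g => ?_
    have h1 := congrFun heq g⁻¹
    rw [← B.inner_vec, ← inv_inv g⁻¹, ← inner_lam_left, ← inner_lam_left, inv_inv] at h1
    rw [inner_smul_left, ← inner_conj_symm, ← inner_conj_symm B.vec, ← h1, map_mul,
      ← mul_assoc, Complex.conj_ofReal, Complex.conj_ofReal, ← Complex.ofReal_mul,
      mul_inv_cancel₀ ht'.ne', Complex.ofReal_one, one_mul]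
  have hv : B.vec = (((‖K.starProjection B.vec‖ ^ 2 : ℝ) : ℂ))⁻¹ • K.starProjection B.vec :=
    ((inv_smul_eq_iff₀ (Complex.ofReal_ne_zero.2 ht'.ne')).2 hp).symm
  rw [hv]
  exact K.smul_mem _ (Submodule.starProjection_apply_mem _ _)

end BiRep

/-! ### Unipotent and triangular matrices in SL₂(R). -/

section Matrices

variable {R : Type*} [CommRing R]

/-- The lower unipotent matrix `(1, 0; b, 1)`. -/
def lowerUnit (b : R) : Matrix.SpecialLinearGroup (Fin 2) R :=
  ⟨!![1, 0; b, 1], by simp [Matrix.det_fin_two]⟩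

theorem upper_transpose_one (b : R) : (upper 1 b).transpose = lowerUnit b := by
  ext i j
  change upper 1 b j i = lowerUnit b i j
  fin_cases i <;> fin_cases j <;> simp [upper, lowerUnit]

theorem lowerUnit_mul (b c : R) : lowerUnit b * lowerUnit c = lowerUnit (b + c) := by
  ext i j
  rw [Matrix.SpecialLinearGroup.coe_mul]
  fin_cases i <;> fin_cases j <;> simp [lowerUnit, Matrix.mul_apply, Fin.sum_univ_two]

theorem lowerUnit_zero : lowerUnit (0 : R) = 1 := by
  ext i j
  fin_cases i <;> fin_cases j <;> simp [lowerUnit]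

theorem lowerUnit_inv (b : R) : (lowerUnit b)⁻¹ = lowerUnit (-b) := by
  rw [inv_eq_iff_mul_eq_one, lowerUnit_mul, add_neg_cancel, lowerUnit_zero]

theorem upper_inv (a : Rˣ) (b : R) : (upper a b)⁻¹ = upper a⁻¹ (-b) := by
  rw [inv_eq_iff_mul_eq_one, upper_mul, ← upper_one_zero]
  simp [mul_comm]

theorem upper_zero_mul_lowerUnit (a : Rˣ) (b : R) :
    upper a 0 * lowerUnit b = lowerUnit (((a⁻¹ ^ 2 : Rˣ) : R) * b) * upper a 0 := by
  ext i j
  rw [Matrix.SpecialLinearGroup.coe_mul, Matrix.SpecialLinearGroup.coe_mul]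
  fin_cases i <;> fin_cases j <;>
    simp [lowerUnit, upper, Matrix.mul_apply, Fin.sum_univ_two]
  rw [sq, mul_assoc, mul_assoc, mul_comm b, Units.inv_mul_cancel_left]

/-- The upper unipotent matrices with entry in an ideal. -/
def upperUnipotent (I : Ideal R) : Subgroup (Matrix.SpecialLinearGroup (Fin 2) R) where
  carrier := {g | ∃ β ∈ I, g = upper 1 β}
  one_mem' := ⟨0, I.zero_mem, upper_one_zero.symm⟩
  mul_mem' := by
    rintro _ _ ⟨β, hβ, rfl⟩ ⟨γ, hγ, rfl⟩
    exact ⟨γ + β, I.add_mem hγ hβ, by simp [upper_mul]⟩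
  inv_mem' := by
    rintro _ ⟨β, hβ, rfl⟩
    exact ⟨-β, I.neg_mem hβ, by rw [upper_inv, inv_one]⟩

/-- The lower unipotent matrices with entry in an ideal. -/
def lowerUnipotent (I : Ideal R) : Subgroup (Matrix.SpecialLinearGroup (Fin 2) R) where
  carrier := {g | ∃ β ∈ I, g = lowerUnit β}
  one_mem' := ⟨0, I.zero_mem, lowerUnit_zero.symm⟩
  mul_mem' := by
    rintro _ _ ⟨β, hβ, rfl⟩ ⟨γ, hγ, rfl⟩
    exact ⟨β + γ, I.add_mem hβ hγ, lowerUnit_mul _ _⟩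
  inv_mem' := by
    rintro _ ⟨β, hβ, rfl⟩
    exact ⟨-β, I.neg_mem hβ, lowerUnit_inv _⟩

theorem upperUnipotent_mono {I J : Ideal R} (h : I ≤ J) : upperUnipotent I ≤ upperUnipotent J := by
  rintro _ ⟨β, hβ, rfl⟩
  exact ⟨β, h hβ, rfl⟩

theorem lowerUnipotent_mono {I J : Ideal R} (h : I ≤ J) : lowerUnipotent I ≤ lowerUnipotent J := by
  rintro _ ⟨β, hβ, rfl⟩
  exact ⟨β, h hβ, rfl⟩

theorem mem_normalizer_of_conj_mem {G : Type*} [Group G] {S : Subgroup G} {g : G}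
    (h1 : ∀ s ∈ S, g * s * g⁻¹ ∈ S) (h2 : ∀ s ∈ S, g⁻¹ * s * g ∈ S) :
    g ∈ Subgroup.normalizer (S : Set G) := by
  refine Subgroup.mem_normalizer_iff.2 fun s => ⟨h1 s, fun hs => ?_⟩
  have := h2 _ hs
  rwa [show g⁻¹ * (g * s * g⁻¹) * g = s by group] at this

theorem upper_mem_normalizer (a : Rˣ) (b : R) (I : Ideal R) :
    upper a b ∈
      Subgroup.normalizer (upperUnipotent I : Set (Matrix.SpecialLinearGroup (Fin 2) R)) := by
  have key : ∀ (a : Rˣ) (b : R), ∀ s ∈ upperUnipotent I,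
      upper a b * s * (upper a b)⁻¹ ∈ upperUnipotent I := by
    rintro a b _ ⟨x, hx, rfl⟩
    refine ⟨(a : R) ^ 2 * x, I.mul_mem_left _ hx, ?_⟩
    rw [mul_inv_eq_iff_eq_mul, upper_mul, upper_mul]
    simp only [mul_one, one_mul, inv_one, Units.val_one]
    congr 1
    have := a.mul_inv
    linear_combination (-(a : R) * x) * this
  refine mem_normalizer_of_conj_mem (key a b) fun s hs => ?_
  have := key a⁻¹ (-b) s hs
  rwa [← upper_inv, inv_inv] at this

theorem upper_zero_mem_normalizer (a : Rˣ) (I : Ideal R) :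
    upper a 0 ∈
      Subgroup.normalizer (lowerUnipotent I : Set (Matrix.SpecialLinearGroup (Fin 2) R)) := by
  have key : ∀ a : Rˣ, ∀ s ∈ lowerUnipotent I,
      upper a 0 * s * (upper a 0)⁻¹ ∈ lowerUnipotent I := by
    rintro a _ ⟨x, hx, rfl⟩
    refine ⟨((a⁻¹ ^ 2 : Rˣ) : R) * x, I.mul_mem_left _ hx, ?_⟩
    rw [mul_inv_eq_iff_eq_mul, upper_zero_mul_lowerUnit]
  refine mem_normalizer_of_conj_mem (key a) fun s hs => ?_
  have := key a⁻¹ s hs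
  have e : upper a⁻¹ (0 : R) = (upper a 0)⁻¹ := by rw [upper_inv, neg_zero]
  rwa [e, inv_inv] at this

theorem lowerUnit_mem_normalizer (b : R) (I : Ideal R) :
    lowerUnit b ∈
      Subgroup.normalizer (lowerUnipotent I : Set (Matrix.SpecialLinearGroup (Fin 2) R)) := by
  refine mem_normalizer_of_conj_mem ?_ ?_ <;> rintro _ ⟨x, hx, rfl⟩ <;> refine ⟨x, hx, ?_⟩ <;>
    rw [lowerUnit_inv, lowerUnit_mul, lowerUnit_mul] <;> congr 1 <;> ring

theorem displaces_upper {I : ℕ → Ideal R} {b : Rˣ} (γ : R)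
    (h : ∃ l, I l ≤ Ideal.span {(b : R) ^ 2 - 1}) :
    BiRep.Displaces (fun l => upperUnipotent (I l)) (upper b γ) := by
  obtain ⟨l, hl⟩ := h
  refine ⟨l, ?_⟩
  rintro _ ⟨x, hx, rfl⟩
  obtain ⟨y, rfl⟩ := Ideal.mem_span_singleton'.1 (hl hx)
  -- Conjugation changes the corner by y(b - b⁻¹) = xb⁻¹, where x = y(b² - 1).
  refine ⟨upper 1 (-y), fun m => upper_mem_normalizer _ _ _, ?_⟩
  rw [mul_inv_eq_iff_eq_mul, upper_mul, upper_mul, upper_mul]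
  simp only [mul_one, one_mul, inv_one, Units.val_one]
  congr 1
  have := b.mul_inv
  linear_combination (-(b : R) * y) * this

theorem displaces_lower {I : ℕ → Ideal R} {b : Rˣ}
    (h : ∃ l, I l ≤ Ideal.span {(b : R) ^ 2 - 1}) :
    BiRep.Displaces (fun l => lowerUnipotent (I l)) (upper b 0) := by
  obtain ⟨l, hl⟩ := h
  refine ⟨l, ?_⟩
  rintro _ ⟨x, hx, rfl⟩
  obtain ⟨y, rfl⟩ := Ideal.mem_span_singleton'.1 (hl hx)
  -- Conjugation by `lowerUnit z` multiplies the diagonal matrix on the left by `lowerUnit` of z -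
  -- b⁻²z; z = yb² makes this y(b² - 1).
  refine ⟨lowerUnit (y * (b : R) ^ 2), fun m => lowerUnit_mem_normalizer _ _, ?_⟩
  rw [mul_inv_eq_iff_eq_mul, mul_assoc, upper_zero_mul_lowerUnit, ← mul_assoc, lowerUnit_mul]
  congr 2
  have := b.mul_inv
  rw [Units.val_pow_eq_pow_val]
  linear_combination (-y * ((b : R) * ((b⁻¹ : Rˣ) : R) + 1)) * this

/-- A nonvanishing character along an infinite family of upper triangular matrices yields a vector
fixed by the elementary group of an ideal. -/
theorem exists_fixed_elementary {τ : Matrix.SpecialLinearGroup (Fin 2) R → ℂ} {H : Type*}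
    [NormedAddCommGroup H] [InnerProductSpace ℂ H] [CompleteSpace H] (B : BiRep τ H)
    {ι : Type*} [Infinite ι] {I : ℕ → Ideal R} (hI : Antitone I) (a : ι → Rˣ) (β : ι → R)
    (hfin : ∀ m, ∃ Y : Set R, Y.Finite ∧ ∀ y, ∃ y₀ ∈ Y, y - y₀ ∈ I m)
    (hd : ∀ i j, i ≠ j → ∃ l, I l ≤ Ideal.span {((((a j)⁻¹ * a i : Rˣ) : R)) ^ 2 - 1})
    {ε : ℝ} (hε : 0 < ε) (hτ : ∀ i, ε ≤ ‖τ (upper (a i) (β i))‖) :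
    ∃ l, ∃ v ≠ 0, v ∈ B.fixed (upperUnipotent (I l) ⊔ lowerUnipotent (I l)) := by
  obtain ⟨l, v, hv0, hv1, hv2⟩ := B.exists_fixed (V := fun l => upperUnipotent (I l))
    (W := fun l => lowerUnipotent (I l)) (fun i j h => upperUnipotent_mono (hI h))
    (fun i j h => lowerUnipotent_mono (hI h)) (a := fun i => upper (a i) 0)
    (d := fun i => upper (a i) (β i)) (fun i m => upper_mem_normalizer _ _ _)
    (fun i m => upper_mem_normalizer _ _ _) (fun i m => upper_zero_mem_normalizer _ _)
    (fun i j hij => by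
      rw [upper_inv, upper_mul]
      exact displaces_upper _ (hd i j hij))
    (fun i j hij => by
      rw [upper_inv, upper_mul, neg_zero, zero_mul, mul_zero, add_zero]
      exact displaces_lower (hd i j hij))
    (fun m => by
      obtain ⟨Y, hY, h⟩ := hfin m
      refine ⟨upper 1 '' Y, hY.image _, ?_, fun i => ?_⟩
      · rintro _ ⟨y, -, rfl⟩
        exact upper_mem_normalizer _ _ _
      -- The unipotent factor of `upper a β` to the right of its diagonal part has entry a⁻¹β.
      · obtain ⟨y₀, hy₀, hy⟩ := h (((a i)⁻¹ : Rˣ) * β i)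
        refine ⟨upper 1 y₀, ⟨y₀, hy₀, rfl⟩, _, hy, ?_⟩
        rw [inv_mul_eq_iff_eq_mul, upper_mul, upper_mul]
        simp [mul_sub])
    hε hτ
  exact ⟨l, v, hv0, BiRep.mem_fixed_sup hv1 hv2⟩

theorem unipotentPair_le (α : Rˣ) :
    unipotentPair α ≤ upperUnipotent (Ideal.span {(α : R) ^ 2 - 1}) ⊔
      lowerUnipotent (Ideal.span {(α : R) ^ 2 - 1}) := by
  refine (Subgroup.closure_le _).2 (Set.union_subset ?_ ?_)
  · exact (le_sup_left : upperUnipotent (Ideal.span {(α : R) ^ 2 - 1}) ≤ _)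
  · rintro _ ⟨_, ⟨β, hβ, rfl⟩, rfl⟩
    exact (le_sup_right : lowerUnipotent _ ≤ _) ⟨β, hβ, upper_transpose_one β⟩

/-- The pair lies in the kernel of reduction modulo the ideal. -/
theorem mem_of_upper_mem_unipotentPair {α : Rˣ} {y : R} (h : upper 1 y ∈ unipotentPair α) :
    y ∈ Ideal.span {(α : R) ^ 2 - 1} := by
  set I := Ideal.span {(α : R) ^ 2 - 1} with hI
  have hle : unipotentPair α ≤
      (Matrix.SpecialLinearGroup.map (n := Fin 2) (Ideal.Quotient.mk I)).ker := by
    refine (unipotentPair_le α).trans (sup_le ?_ ?_)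
    · rintro _ ⟨β, hβ, rfl⟩
      rw [MonoidHom.mem_ker]
      ext i j
      change Ideal.Quotient.mk I (upper 1 β i j) = (1 : Matrix (Fin 2) (Fin 2) (R ⧸ I)) i j
      fin_cases i <;> fin_cases j <;> simp [upper]
      exact Ideal.Quotient.eq_zero_iff_mem.2 hβ
    · rintro _ ⟨β, hβ, rfl⟩
      rw [MonoidHom.mem_ker]
      ext i j
      change Ideal.Quotient.mk I (lowerUnit β i j) = (1 : Matrix (Fin 2) (Fin 2) (R ⧸ I)) i j
      fin_cases i <;> fin_cases j <;> simp [lowerUnit]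
      exact Ideal.Quotient.eq_zero_iff_mem.2 hβ
  have h1 := MonoidHom.mem_ker.1 (hle h)
  have h2 : Ideal.Quotient.mk I (upper 1 y 0 1) = (1 : Matrix (Fin 2) (Fin 2) (R ⧸ I)) 0 1 :=
    congrArg (fun g : Matrix.SpecialLinearGroup (Fin 2) (R ⧸ I) => g 0 1) h1
  exact Ideal.Quotient.eq_zero_iff_mem.1 (by simpa [upper] using h2)

/-- Unipotents in the same coset have congruent entries, so finite index makes R/(α² - 1) finite. -/
theorem exists_finite_representatives {α : Rˣ} (h : (unipotentPair α).FiniteIndex) :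
    ∃ Y : Set R, Y.Finite ∧ ∀ y, ∃ y₀ ∈ Y, y - y₀ ∈ Ideal.span {(α : R) ^ 2 - 1} := by
  let q : R → Matrix.SpecialLinearGroup (Fin 2) R ⧸ unipotentPair α := fun y =>
    QuotientGroup.mk (upper 1 y)
  have : Finite (Matrix.SpecialLinearGroup (Fin 2) R ⧸ unipotentPair α) :=
    Subgroup.finite_quotient_of_finiteIndex
  refine ⟨Set.range fun r : Set.range q => r.2.choose, Set.finite_range _, fun y => ?_⟩
  refine ⟨_, ⟨⟨q y, y, rfl⟩, rfl⟩, mem_of_upper_mem_unipotentPair ?_⟩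
  have hc : q (Set.mem_range_self (f := q) y).choose = q y :=
    (Set.mem_range_self (f := q) y).choose_spec
  have := QuotientGroup.eq.1 hc
  rw [upper_inv, upper_mul] at this
  simpa [sub_eq_add_neg] using this

theorem elementary_eq_top_of_isField (hF : IsField R) :
    upperUnipotent (⊤ : Ideal R) ⊔ lowerUnipotent ⊤ = ⊤ := by
  set E := upperUnipotent (⊤ : Ideal R) ⊔ lowerUnipotent ⊤ with hE
  have hu : ∀ x : R, upper 1 x ∈ E := fun x =>
    (le_sup_left : upperUnipotent _ ≤ E) ⟨x, trivial, rfl⟩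
  have hl : ∀ x : R, lowerUnit x ∈ E := fun x =>
    (le_sup_right : lowerUnipotent _ ≤ E) ⟨x, trivial, rfl⟩
  have key : ∀ g : Matrix.SpecialLinearGroup (Fin 2) R, g 1 0 ≠ 0 → g ∈ E := fun g hg => by
    obtain ⟨t, ht⟩ := hF.mul_inv_cancel hg
    have hdet := g.det_coe
    rw [Matrix.det_fin_two] at hdet
    have : g = upper 1 ((g 0 0 - 1) * t) * lowerUnit (g 1 0) *
        upper 1 ((g 1 1 - 1) * t) := by
      ext i j
      rw [Matrix.SpecialLinearGroup.coe_mul, Matrix.SpecialLinearGroup.coe_mul]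
      fin_cases i <;> fin_cases j <;>
        simp [lowerUnit, upper, Matrix.mul_apply, Fin.sum_univ_two]
      · linear_combination (1 - g 0 0) * ht
      · linear_combination (-g 0 1 - (g 0 0 - 1) * (g 1 1 - 1) * t) * ht - t * hdet
      · linear_combination (1 - g 1 1) * ht
    rw [this]
    exact mul_mem (mul_mem (hu _) (hl _)) (hu _)
  refine eq_top_iff.2 fun g _ => ?_
  by_cases hg : g 1 0 = 0
  -- Adding the top row to the bottom one puts g 0 0 in the corner, nonzero because the determinant
  -- is 1.
  · have h1 : lowerUnit 1 * g ∈ E := key _ (by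
      rw [Matrix.SpecialLinearGroup.coe_mul]
      simp [lowerUnit, Matrix.mul_apply, Fin.sum_univ_two]
      rw [hg, add_zero]
      intro h0
      have hdet := g.det_coe
      rw [Matrix.det_fin_two, hg, h0] at hdet
      obtain ⟨x, y, hxy⟩ := hF.exists_pair_ne
      apply hxy
      rw [← one_mul x, ← one_mul y, ← hdet]
      ring)
    have h2 := mul_mem (inv_mem (hl 1)) h1
    rwa [inv_mul_cancel_left] at h2
  · exact key g hg

end Matrices

/-! ### The two alternatives for extremal characters. -/

section Main

theorem BiRep.apply_eq_of_mem_fixed {Γ : Type*} [Group Γ] {τ : Γ → ℂ} {H : Type*}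
    [NormedAddCommGroup H] [InnerProductSpace ℂ H] (B : BiRep τ H) {N : Subgroup Γ}
    (h : B.vec ∈ B.fixed N) {g g' : Γ} (hg : g⁻¹ * g' ∈ N) : τ g = τ g' := by
  rw [← B.inner_vec, ← B.inner_vec, show g' = g * (g⁻¹ * g') by group, B.lam_mul, h _ hg]

theorem BiRep.factorsThroughFiniteQuotient {Γ : Type*} [Group Γ] {τ : Γ → ℂ} {H : Type*}
    [NormedAddCommGroup H] [InnerProductSpace ℂ H] [CompleteSpace H] (B : BiRep τ H)
    (hτ : IsExtremalCharacter τ) {S : Subgroup Γ} (hS : S.FiniteIndex) {v : H} (hv0 : v ≠ 0)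
    (hv : v ∈ B.fixed S) : FactorsThroughFiniteQuotient τ := by
  have hN : S.normalCore.Normal := S.normalCore_normal
  have hfix := B.vec_mem_fixed_of_extremal hτ hN fun h => hv0 ((Submodule.mem_bot ℂ).1
    (h ▸ BiRep.fixed_anti S.normalCore_le hv))
  refine ⟨S.normalCore, hN, inferInstance, fun q => τ q.out, fun g => ?_⟩
  exact B.apply_eq_of_mem_fixed hfix (QuotientGroup.eq.1 (QuotientGroup.out_eq' _).symm)

variable {R : Type*} [CommRing R]

/-- For a negative quotient, u⁻² - 1 is a unit multiple of u² - 1. -/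
theorem sq_sub_one_dvd_of_zpow (α : Rˣ) {k : ℤ} {n : ℕ} (h : k ∣ n) :
    (((α ^ k : Rˣ) : R)) ^ 2 - 1 ∣ ((α ^ n : Rˣ) : R) ^ 2 - 1 := by
  obtain ⟨j, hj⟩ := h
  have key : ∀ (u : Rˣ) (m : ℕ), (u : R) ^ 2 - 1 ∣ ((u ^ m : Rˣ) : R) ^ 2 - 1 := fun u m => by
    rw [Units.val_pow_eq_pow_val, ← pow_mul, mul_comm, pow_mul]
    simpa using sub_dvd_pow_sub_pow ((u : R) ^ 2) 1 m
  have hinv : ∀ (u : Rˣ) (x : R), (u : R) ^ 2 - 1 ∣ x → ((u⁻¹ : Rˣ) : R) ^ 2 - 1 ∣ x := by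
    rintro u _ ⟨c, rfl⟩
    refine ⟨-(u : R) ^ 2 * c, ?_⟩
    have := u.mul_inv
    linear_combination (c * ((u : R) * ((u⁻¹ : Rˣ) : R) + 1)) * this
  have hn : (α ^ n : Rˣ) = (α ^ k) ^ j := by rw [← zpow_natCast, hj, zpow_mul]
  obtain ⟨m, rfl | rfl⟩ := j.eq_nat_or_neg
  · rw [hn, zpow_natCast]; exact key _ _
  · rw [hn, zpow_neg, zpow_natCast, ← inv_pow]
    have := hinv _ _ (key (α ^ k)⁻¹ m)
    rwa [inv_inv] at this

theorem factors_or_small (hR : ∀ α : Rˣ, α ^ 2 ≠ 1 → (unipotentPair α).FiniteIndex)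
    (τ : Matrix.SpecialLinearGroup (Fin 2) R → ℂ) (hτ : IsExtremalCharacter τ) :
    FactorsThroughFiniteQuotient τ ∨
      ∀ ε : ℝ, 0 < ε → ∀ α : Rˣ, ¬ IsOfFinOrder α →
        ∃ k₀ : ℕ, ∀ β : R, ∀ k : ℤ, (k₀ : ℤ) ≤ |k| → ‖τ (upper (α ^ k) β)‖ < ε := by
  obtain ⟨H, _, _, _, ⟨B⟩⟩ := hτ.1.1.exists_biRep
  refine or_iff_not_imp_right.2 fun hcon => ?_
  push Not at hcon
  obtain ⟨ε, hε, α, hα, hk⟩ := hcon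
  let S : Set ℤ := {k | ∃ β, ε ≤ ‖τ (upper (α ^ k) β)‖}
  have hS : S.Infinite := fun hfin => by
    obtain ⟨M, hM⟩ := (hfin.image Int.natAbs).bddAbove
    obtain ⟨β, k, hk1, hk2⟩ := hk (M + 1)
    have := hM ⟨k, ⟨β, hk2⟩, rfl⟩
    rw [Int.abs_eq_natAbs] at hk1
    omega
  have : Infinite S := hS.to_subtype
  have hne : ∀ l : ℕ, (α ^ l.factorial) ^ 2 ≠ 1 := fun l h => hα
    (isOfFinOrder_iff_pow_eq_one.2 ⟨l.factorial * 2, by positivity, by rwa [pow_mul]⟩)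
  -- Factorials make the ideals decreasing and give, for any exponents i ≠ j, a member inside
  -- (α^(2(i-j)) - 1), namely l = |i - j|.
  obtain ⟨l, v, hv0, hv⟩ := exists_fixed_elementary B
    (I := fun l => Ideal.span {((α ^ l.factorial : Rˣ) : R) ^ 2 - 1})
    (fun l l' h => by
      rw [Ideal.span_singleton_le_span_singleton, ← zpow_natCast α l.factorial]
      exact sq_sub_one_dvd_of_zpow α (Int.natCast_dvd_natCast.2 (Nat.factorial_dvd_factorial h)))
    (fun k : S => α ^ (k : ℤ)) (fun k => k.2.choose)
    (fun m => exists_finite_representatives (hR _ (hne m)))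
    (fun i j hij => by
      refine ⟨((i : ℤ) - j).natAbs, ?_⟩
      rw [Ideal.span_singleton_le_span_singleton, ← zpow_neg, ← zpow_add]
      refine sq_sub_one_dvd_of_zpow α ?_
      rw [neg_add_eq_sub, ← Int.natAbs_dvd, Int.natCast_dvd_natCast]
      exact Nat.dvd_factorial
        (Int.natAbs_pos.2 (sub_ne_zero.2 fun h => hij (Subtype.ext h))) le_rfl)
    hε (fun k => k.2.choose_spec)
  exact B.factorsThroughFiniteQuotient hτ (hR _ (hne l)) hv0
    (BiRep.fixed_anti (unipotentPair_le _) hv)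

theorem eq_one_or_tendsto_zero (hF : IsField R)
    (τ : Matrix.SpecialLinearGroup (Fin 2) R → ℂ) (hτ : IsExtremalCharacter τ) :
    (∀ g, τ g = 1) ∨
      Filter.Tendsto (fun d : diagonalSubgroup R => τ d) Filter.cofinite (nhds 0) := by
  obtain ⟨H, _, _, _, ⟨B⟩⟩ := hτ.1.1.exists_biRep
  have hdom : IsDomain R := hF.isDomain
  refine or_iff_not_imp_right.2 fun hcon g => ?_
  obtain ⟨ε, hε, hinf⟩ : ∃ ε > 0, {d : diagonalSubgroup R | ε ≤ ‖τ d‖}.Infinite := by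
    by_contra! h
    refine hcon (Metric.tendsto_nhds.2 fun ε hε => ?_)
    have := h ε hε
    rw [Filter.eventually_cofinite]
    simpa using this
  let A : Set Rˣ := {a | ε ≤ ‖τ (upper a 0)‖}
  have hA : A.Infinite := fun hfin => hinf <|
    (hfin.image fun a => (⟨upper a 0, a, rfl⟩ : diagonalSubgroup R)).subset <| by
      rintro ⟨_, a, rfl⟩ hd
      exact ⟨a, hd, rfl⟩
  -- One unit is chosen for each square, so that distinct indices give (a_j⁻¹a_i)² ≠ 1; squaring has
  -- fibres of at most two elements, so T stays infinite.
  let T : Set Rˣ := (fun a => a ^ 2) '' A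
  have hT : T.Infinite := fun hfin => hA <|
    (hfin.preimage' (f := fun a : Rˣ => a ^ 2) (by
      rintro _ ⟨b, -, rfl⟩
      refine (Set.toFinite {b, -b}).subset fun a ha => ?_
      have h1 : (a : R) ^ 2 = (b : R) ^ 2 := by exact_mod_cast congrArg Units.val ha
      rcases sq_eq_sq_iff_eq_or_eq_neg.1 h1 with h | h
      · exact Or.inl (Units.ext h)
      · exact Or.inr (Units.ext (by simpa using h)))).subset (Set.subset_preimage_image _ _)
  have : Infinite T := hT.to_subtype
  -- In a field a nonzero b² - 1 generates the unit ideal, so a constant sequence serves and 0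
  -- represents every residue.
  obtain ⟨l, v, hv0, hv⟩ := exists_fixed_elementary B (I := fun _ => ⊤) (fun _ _ _ => le_rfl)
    (fun t : T => t.2.choose) (fun _ => 0)
    (fun _ => ⟨{0}, Set.finite_singleton 0, fun y => ⟨0, rfl, trivial⟩⟩)
    (fun i j hij => by
      refine ⟨0, ?_⟩
      have hne : ((((j.2.choose)⁻¹ * i.2.choose : Rˣ) : R)) ^ 2 - 1 ≠ 0 := fun h => by
        have h1 : ((j.2.choose)⁻¹ * i.2.choose : Rˣ) ^ 2 = 1 :=
          Units.ext (by rw [Units.val_pow_eq_pow_val, Units.val_one]; exact sub_eq_zero.1 h)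
        rw [mul_pow, inv_pow, inv_mul_eq_one] at h1
        exact hij (Subtype.ext (i.2.choose_spec.2.symm.trans (h1.symm.trans j.2.choose_spec.2)))
      obtain ⟨t, ht⟩ := hF.mul_inv_cancel hne
      exact ((Ideal.eq_top_iff_one _).2 (Ideal.mem_span_singleton.2 ⟨t, ht.symm⟩)).ge)
    hε (fun t => t.2.choose_spec.1)
  rw [elementary_eq_top_of_isField hF] at hv
  have hfix := B.vec_mem_fixed_of_extremal hτ (inferInstance : (⊤ : Subgroup _).Normal) fun h =>
    hv0 ((Submodule.mem_bot ℂ).1 (h ▸ hv))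
  rw [B.apply_eq_of_mem_fixed hfix (g := g) (g' := 1) trivial]
  exact hτ.1.2

end Main

end CharSL2

theorem mainTheorem3 {R : Type*} [CommRing R]
    (hR : ∀ α : Rˣ, α ^ 2 ≠ 1 → (CharSL2.unipotentPair α).FiniteIndex)
    (τ : Matrix.SpecialLinearGroup (Fin 2) R → ℂ) (hτ : CharSL2.IsExtremalCharacter τ) :
    (CharSL2.FactorsThroughFiniteQuotient τ ∨
      ∀ ε : ℝ, 0 < ε → ∀ α : Rˣ, ¬ IsOfFinOrder α →
        ∃ k₀ : ℕ, ∀ β : R, ∀ k : ℤ, (k₀ : ℤ) ≤ |k| →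
          ‖τ (CharSL2.upper (α ^ k) β)‖ < ε) ∧
    (IsField R →
      (∀ g, τ g = 1) ∨
      Filter.Tendsto (fun d : CharSL2.diagonalSubgroup R => τ d) Filter.cofinite (nhds 0)) :=
  ⟨CharSL2.factors_or_small hR τ hτ, fun hF => CharSL2.eq_one_or_tendsto_zero hF τ hτ⟩
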